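/- A cluster graph is a graph without an induced path on three vertices, that is, a disjoint union of cliques (its clusters). For two cluster graphs $G_1=(V,E_1)$, $G_2=(V,E_2)$ on the same finite vertex set, the edge-based distance is $d_E(G_1,G_2)=|E_1\oplus E_2|$, where $\oplus$ denotes the symmetric difference. The matching-based distance is $d_M(G_1,G_2)=|V|-W$, where $W$ is the maximum weight of a matching in the complete bipartite graph whose sides are the clusters of $G_1$ and the clusters of $G_2$ and in which the edge between clusters $C$ and $D$ has weight $|C\cap D|$. An instance of Dynamic Cluster Editing is $(G,G_c,k,d)$ with a finite undirected graph $G=(V,E)$, a cluster graph $G_c$ on $V$, and nonnegative integers $k,d$. The question is whether there is a cluster graph $G'$ on $V$ with $|E(G)\oplus E(G')|\le k$ and $\mathrm{dist}(G',G_c)\le d$. In Dynamic Cluster Deletion one requires in addition $E(G')\subseteq E(G)$, in Dynamic Cluster Completion $E(G)\subseteq E(G')$. With $\mathrm{dist}=d_M$ or $\mathrm{dist}=d_E$ this gives three matching-based and three edge-based problems. **Theorem.** Each of the three matching-based problems admits a kernel with $O(k^2+d^2)$ vertices, and each of the three edge-based problems admits a kernel with $O(k^2+k\cdot d)$ vertices.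 All these kernels can be computed in $O(|V|^3)$ time. Precisely: put $f(k,d)=k^2+d^2$ for the matching-based and $f(k,d)=k^2+k\cdot d$ for the edge-based problems. For each of the six problems there are a constant $c$ and a random access machine program, with unit-cost operations on words of $O(\log(|V|+k+d))$ bits and graphs given by adjacency matrices, which on every instance $(G=(V,E),G_c,k,d)$ stops after at most $c\,(|V|^3+1)$ steps and outputs an instance $(G^*,G_c^*,k^*,d^*)$ of the same problem that is a yes-instance if and only if $(G,G_c,k,d)$ is one, such that $G^*$ has at most $c\,(f(k,d)+1)$ vertices, $k^*\le k$, and $d^*\le d$. -/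

import Mathlib

namespace DynamicCluster

/-! ### Cluster graphs and their distances -/

/-- A cluster graph: no three vertices `u, v, w` induce a path `u - v - w`. -/
def IsClusterGraph {V : Type*} (G : SimpleGraph V) : Prop :=
  ∀ u v w : V, ¬ (G.Adj u v ∧ G.Adj v w ∧ u ≠ w ∧ ¬ G.Adj u w)

/-- The number of edges in the symmetric difference of the two edge sets, `|E(G₁) ⊕ E(G₂)|`. -/
noncomputable def edgeDist {V : Type*} (G₁ G₂ : SimpleGraph V) : ℕ :=
  (symmDiff G₁.edgeSet G₂.edgeSet).ncard

/-- A matching in the complete bipartite graph whose two sides are the clusters (that is, the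
connected components) of `G₁` and of `G₂`, as a set of edges: no two distinct edges of `M` share an
endpoint. -/
def IsClusterMatching {V : Type*} {G₁ G₂ : SimpleGraph V}
    (M : Finset (G₁.ConnectedComponent × G₂.ConnectedComponent)) : Prop :=
  ∀ p ∈ M, ∀ q ∈ M, (p.1 = q.1 ∨ p.2 = q.2) → p = q

/-- The weight of a set of pairs of clusters: the pair `(C, D)` has weight `|C ∩ D|`. -/
noncomputable def matchingWeight {V : Type*} {G₁ G₂ : SimpleGraph V}
    (M : Finset (G₁.ConnectedComponent × G₂.ConnectedComponent)) : ℕ :=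
  ∑ p ∈ M, (p.1.supp ∩ p.2.supp).ncard

/-- The weight of a maximum-weight matching between the clusters of `G₁` and those of `G₂`. On a
finite vertex set this is the maximum of a nonempty set that is bounded by `|V|`. -/
noncomputable def maxMatchingWeight {V : Type*} (G₁ G₂ : SimpleGraph V) : ℕ :=
  sSup {w : ℕ | ∃ M : Finset (G₁.ConnectedComponent × G₂.ConnectedComponent),
    IsClusterMatching M ∧ matchingWeight M = w}

/-- The matching-based distance `|V| - W`. -/
noncomputable def matchingDist {V : Type*} [Fintype V] (G₁ G₂ : SimpleGraph V) : ℕ :=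
  Fintype.card V - maxMatchingWeight G₁ G₂

/-! ### The six problems -/

/-- Which edge modifications are allowed. -/
inductive Modification where
  | editing
  | deletion
  | completion

/-- Which distance between cluster graphs is used. -/
inductive Distance where
  | matching
  | edge

/-- `G'` may be obtained from `G` by the allowed kind of modifications. -/
def Modification.Allows {V : Type*} : Modification → SimpleGraph V → SimpleGraph V → Prop
  | .editing, _, _ => True
  | .deletion, G, G' => G'.edgeSet ⊆ G.edgeSet
  | .completion, G, G' => G.edgeSet ⊆ G'.edgeSet

noncomputable def Distance.dist {V : Type*} [Fintype V] :
    Distance → SimpleGraph V → SimpleGraph V → ℕ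
  | .matching, G₁, G₂ => matchingDist G₁ G₂
  | .edge, G₁, G₂ => edgeDist G₁ G₂

/-- An instance `(G, G_c, k, d)`, with vertex set `{0, …, n - 1}`. -/
structure DCInstance where
  n : ℕ
  G : SimpleGraph (Fin n)
  Gc : SimpleGraph (Fin n)
  isClusterGraph_Gc : IsClusterGraph Gc
  k : ℕ
  d : ℕ

/-- The instance is a yes-instance of the variant given by `δ` and `m`. -/
def DCInstance.IsYes (I : DCInstance) (δ : Distance) (m : Modification) : Prop :=
  ∃ G' : SimpleGraph (Fin I.n), IsClusterGraph G' ∧ m.Allows I.G G' ∧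
    edgeDist I.G G' ≤ I.k ∧ δ.dist G' I.Gc ≤ I.d

/-! ### Word random access machines

A machine has registers and a fixed number of random access arrays (a program names only finitely
many of each), all holding natural numbers below a bound `W` (words of `log₂ W` bits). Programs are
structured; every evaluation of a node of an expression, every assignment and every test costs one
unit of time. -/

structure State where
  reg : ℕ → ℕ
  mem : ℕ → ℕ → ℕ

inductive BinOp where
  | add
  | sub
  | mul
  | div
  | mod
  | lt
  | eq

/-- Subtraction is truncated, division rounds down, comparisons return `1` or `0`. -/
def BinOp.eval : BinOp → ℕ → ℕ → ℕ
  | .add, x, y => x + y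
  | .sub, x, y => x - y
  | .mul, x, y => x * y
  | .div, x, y => x / y
  | .mod, x, y => x % y
  | .lt, x, y => if x < y then 1 else 0
  | .eq, x, y => if x = y then 1 else 0

inductive Expr where
  /-- a constant -/
  | const (c : ℕ)
  /-- the content of register `r` -/
  | reg (r : ℕ)
  /-- the content of the cell of array `a` whose index is the value of `i` -/
  | load (a : ℕ) (i : Expr)
  | op (o : BinOp) (x y : Expr)

def Expr.eval (s : State) : Expr → ℕ
  | .const c => c
  | .reg r => s.reg r
  | .load a i => s.mem a (i.eval s)
  | .op o x y => o.eval (x.eval s) (y.eval s)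

/-- The time to evaluate an expression. -/
def Expr.cost : Expr → ℕ
  | .const _ => 1
  | .reg _ => 1
  | .load _ i => i.cost + 1
  | .op _ x y => x.cost + y.cost + 1

/-- All numbers that occur in the evaluation of the expression are below `W`. -/
def Expr.Fits (W : ℕ) (s : State) : Expr → Prop
  | .const c => c < W
  | .reg r => s.reg r < W
  | .load a i => i.Fits W s ∧ s.mem a (i.eval s) < W
  | .op o x y => x.Fits W s ∧ y.Fits W s ∧ o.eval (x.eval s) (y.eval s) < W

inductive Cmd where
  | skip
  /-- write the value of `e` into register `r` -/
  | assign (r : ℕ) (e : Expr)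
  /-- write the value of `e` into the cell of array `a` whose index is the value of `i` -/
  | store (a : ℕ) (i e : Expr)
  | seq (p q : Cmd)
  /-- execute `p` if the value of `b` is nonzero, and `q` otherwise -/
  | cond (b : Expr) (p q : Cmd)
  /-- execute `p` as long as the value of `b` is nonzero -/
  | loop (b : Expr) (p : Cmd)

def State.setReg (s : State) (r v : ℕ) : State :=
  { s with reg := Function.update s.reg r v }

def State.setMem (s : State) (a i v : ℕ) : State :=
  { s with mem := Function.update s.mem a (Function.update (s.mem a) i v) }

/-- `Exec W p s t s'`: with words bounded by `W`, the program `p`, started in the state `s`, halts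
after exactly `t` units of time in the state `s'`. A computation that produces a number that does
not fit into a word has no result. -/
inductive Exec (W : ℕ) : Cmd → State → ℕ → State → Prop
  | skip (s : State) : Exec W .skip s 1 s
  | assign (s : State) (r : ℕ) (e : Expr) (he : e.Fits W s) :
      Exec W (.assign r e) s (e.cost + 1) (s.setReg r (e.eval s))
  | store (s : State) (a : ℕ) (i e : Expr) (hi : i.Fits W s) (he : e.Fits W s) :
      Exec W (.store a i e) s (i.cost + e.cost + 1) (s.setMem a (i.eval s) (e.eval s))
  | seq (p q : Cmd) (s s₁ s₂ : State) (t₁ t₂ : ℕ)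
      (hp : Exec W p s t₁ s₁) (hq : Exec W q s₁ t₂ s₂) :
      Exec W (.seq p q) s (t₁ + t₂) s₂
  | condTrue (b : Expr) (p q : Cmd) (s s' : State) (t : ℕ) (hb : b.Fits W s)
      (h : b.eval s ≠ 0) (hp : Exec W p s t s') :
      Exec W (.cond b p q) s (b.cost + 1 + t) s'
  | condFalse (b : Expr) (p q : Cmd) (s s' : State) (t : ℕ) (hb : b.Fits W s)
      (h : b.eval s = 0) (hq : Exec W q s t s') :
      Exec W (.cond b p q) s (b.cost + 1 + t) s'
  | loopDone (b : Expr) (p : Cmd) (s : State) (hb : b.Fits W s) (h : b.eval s = 0) :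
      Exec W (.loop b p) s (b.cost + 1) s
  | loopStep (b : Expr) (p : Cmd) (s s₁ s₂ : State) (t₁ t₂ : ℕ) (hb : b.Fits W s)
      (h : b.eval s ≠ 0) (hp : Exec W p s t₁ s₁) (hl : Exec W (.loop b p) s₁ t₂ s₂) :
      Exec W (.loop b p) s (b.cost + 1 + t₁ + t₂) s₂

/-! ### Instances in memory, and kernels -/

open Classical in
/-- The adjacency matrix of a graph on `{0, …, n - 1}`, row by row, followed by zeros. -/
noncomputable def adjArray {n : ℕ} (G : SimpleGraph (Fin n)) (x : ℕ) : ℕ :=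
  if ∃ i j : Fin n, x = i * n + j ∧ G.Adj i j then 1 else 0

/-- The initial state on input `I`: registers `0, 1, 2` hold `n, k, d`, arrays `0` and `1` hold the
adjacency matrices of `G` and `G_c`, and everything else is zero. -/
noncomputable def DCInstance.input (I : DCInstance) : State where
  reg r := if r = 0 then I.n else if r = 1 then I.k else if r = 2 then I.d else 0
  mem a := if a = 0 then adjArray I.G else if a = 1 then adjArray I.Gc else fun _ => 0

/-- The state `s` holds the instance `J` as output: `n, k, d` in registers `0, 1, 2` and the
adjacency matrices of `G` and `G_c` in the first `n²` cells of the arrays `0` and `1`. -/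
def DCInstance.IsOutput (J : DCInstance) (s : State) : Prop :=
  s.reg 0 = J.n ∧ s.reg 1 = J.k ∧ s.reg 2 = J.d ∧
    ∀ x < J.n ^ 2, s.mem 0 x = adjArray J.G x ∧ s.mem 1 x = adjArray J.Gc x

/-- The variant given by `δ` and `m` has a kernel with `O(f(k, d))` vertices (constantly many where
`f` vanishes) that is computable in time `O(|V|³)`: a single program, on words of
`O(log (|V| + k + d))` bits, maps every instance in `O(|V|³)` steps to an equivalent instance with
at most `c · (f(k, d) + 1)` vertices and with no larger `k` and `d`. -/
def HasCubicTimeVertexKernel (δ : Distance) (m : Modification) (f : ℕ → ℕ → ℕ) : Prop :=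
  ∃ (p : Cmd) (c : ℕ), ∀ I : DCInstance, ∃ (J : DCInstance) (t : ℕ) (s : State),
    Exec ((I.n + I.k + I.d + 2) ^ c) p I.input t s ∧
    t ≤ c * (I.n ^ 3 + 1) ∧
    J.IsOutput s ∧
    (I.IsYes δ m ↔ J.IsYes δ m) ∧
    J.n ≤ c * (f I.k I.d + 1) ∧ J.k ≤ I.k ∧ J.d ≤ I.d

end DynamicCluster

namespace DynamicCluster

/-! ### Polynomially bounded states -/

/-! Call a vertex bad if its neighborhoods in `G` and `Gc` differ. The reduction discards every
cluster of `Gc` without bad vertices, since such a cluster is also a component of `G`. Among twins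
(same closed neighborhood in `G`, same cluster of `Gc`) it keeps only the first `L`, where `L` is
2k+d+1 for the matching and 2k+1 for the edge distance. For the edge distance the remaining bad
vertices are all kept as well.

Equivalence (`isYes_induced_iff`): solutions restrict to induced subinstances. This uses that a
matching distance at most d means agreement after deleting a set `D` of at most d vertices
(`matchingDist_le_iff`), a hereditary condition. Conversely, a discarded vertex outside the common
components has at least `L` kept twins. The modifications touch at most 2k vertices and `D` has at
most d, so some kept twin avoids both, and the discarded vertex is inserted as a copy of it
(`blowUp`, `exists_solution_of_keptSet`). This costs no further modification and no further
distance; in the edge case because discarded vertices are not bad.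

Size: for the matching distance, let `T` consist of `D` and the endpoints of the modified edges of a
solution `G'`, so |T| ≤ 2k+d. Every other kept vertex shares a cluster of `Gc` or of `G'` with an
element of `T`, and such a cluster contains at most `L` kept vertices outside `T`
(`card_keptSet_matching`). For the edge distance the bad vertices, at most 2(k+d) many, play the
role of `T` (`card_keptSet_edge`). A larger kept set certifies a no-instance. The edge bound needs k
≥ 1; for k = 0 the only candidate is `G` itself.

Running time: all data are computed by single counting loops that add into fresh arrays, nested
loops being flattened by division with remainder. The number of rounds is O(n³), and every number
stays polynomial in n+k+d+2, so `Prog.exec_compile` reduces the machine part to evaluating finite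
sums. -/

/-- All numbers stored in `s` are below `B`. -/
def State.Bounded (B : ℕ) (s : State) : Prop :=
  (∀ r, s.reg r < B) ∧ ∀ a i, s.mem a i < B

theorem State.Bounded.mono {B B' : ℕ} {s : State} (h : s.Bounded B) (hB : B ≤ B') :
    s.Bounded B' :=
  ⟨fun r => (h.1 r).trans_le hB, fun a i => (h.2 a i).trans_le hB⟩

theorem State.Bounded.setReg {B : ℕ} {s : State} (h : s.Bounded B) (r : ℕ) {v : ℕ} (hv : v < B) :
    (s.setReg r v).Bounded B := by
  refine ⟨fun r' => ?_, h.2⟩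
  by_cases hr : r' = r
  · simpa [State.setReg, hr] using hv
  · simpa [State.setReg, hr] using h.1 r'

theorem add_lt_pow_of_lt {b x y p q : ℕ} (hb : 2 ≤ b) (hx : x < b ^ p) (hy : y < b ^ q) :
    x + y < b ^ (p + q + 1) := by
  have h1 : b ^ p ≤ b ^ (p + q) := Nat.pow_le_pow_right (by omega) (by omega)
  have h2 : b ^ q ≤ b ^ (p + q) := Nat.pow_le_pow_right (by omega) (by omega)
  have h3 : b ^ (p + q) * 2 ≤ b ^ (p + q + 1) := by
    rw [pow_succ]; exact Nat.mul_le_mul_left _ hb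
  omega

/-- Products add the exponents, and sums need at most one more factor `b`. The extra 1 also leaves
room for the value 1 of a comparison when `p = q = 0`. -/
theorem BinOp.eval_lt {b x y p q : ℕ} (hb : 2 ≤ b) (o : BinOp) (hx : x < b ^ p) (hy : y < b ^ q) :
    o.eval x y < b ^ (p + q + 1) := by
  have h0 := add_lt_pow_of_lt hb hx hy
  have h1 : 1 < b ^ (p + q + 1) := Nat.one_lt_pow (by omega) (by omega)
  cases o with
  | add => exact h0
  | sub => simp only [BinOp.eval]; omega
  | mul =>
    calc x * y < b ^ p * b ^ q := Nat.mul_lt_mul'' hx hy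
      _ = b ^ (p + q) := (pow_add _ _ _).symm
      _ ≤ b ^ (p + q + 1) := Nat.pow_le_pow_right (by omega) (by omega)
  | div => exact (Nat.div_le_self x y).trans_lt (by omega)
  | mod => exact (Nat.mod_le x y).trans_lt (by omega)
  | lt => simp only [BinOp.eval]; split_ifs <;> omega
  | eq => simp only [BinOp.eval]; split_ifs <;> omega

/-- The value of an expression is polynomially bounded, and so are all intermediate results. -/
theorem Expr.exists_bound (e : Expr) (q : ℕ) : ∃ q', q ≤ q' ∧ ∀ b s, 2 ≤ b →
    State.Bounded (b ^ q) s → e.eval s < b ^ q' ∧ ∀ W, b ^ q' ≤ W → e.Fits W s := by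
  induction e with
  | const c =>
    refine ⟨q + c, by omega, fun b s hb _ => ?_⟩
    have h : c < b ^ (q + c) := calc
      c < 2 ^ c := Nat.lt_two_pow_self
      _ ≤ b ^ c := Nat.pow_le_pow_left hb c
      _ ≤ b ^ (q + c) := Nat.pow_le_pow_right (by omega) (by omega)
    exact ⟨h, fun W hW => h.trans_le hW⟩
  | reg r => exact ⟨q, le_rfl, fun b s _ hs => ⟨hs.1 r, fun W hW => (hs.1 r).trans_le hW⟩⟩
  | load a i ih =>
    obtain ⟨q', hq, h⟩ := ih
    refine ⟨q', hq, fun b s hb hs => ?_⟩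
    have h1 : s.mem a (i.eval s) < b ^ q' :=
      (hs.2 _ _).trans_le (Nat.pow_le_pow_right (by omega) hq)
    exact ⟨h1, fun W hW => ⟨(h b s hb hs).2 W hW, h1.trans_le hW⟩⟩
  | op o x y ihx ihy =>
    obtain ⟨p, hp, hx⟩ := ihx
    obtain ⟨p', hp', hy⟩ := ihy
    refine ⟨p + p' + 1, by omega, fun b s hb hs => ?_⟩
    have h := BinOp.eval_lt hb o (hx b s hb hs).1 (hy b s hb hs).1
    refine ⟨h, fun W hW => ⟨(hx b s hb hs).2 W ?_, (hy b s hb hs).2 W ?_, h.trans_le hW⟩⟩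
    · exact (Nat.pow_le_pow_right (by omega) (by omega)).trans hW
    · exact (Nat.pow_le_pow_right (by omega) (by omega)).trans hW

/-! ### Expressions that do not read a given array -/

/-- The expression does not read the array `A`. -/
def Expr.avoids (A : ℕ) : Expr → Bool
  | .const _ => true
  | .reg _ => true
  | .load a i => decide (a ≠ A) && i.avoids A
  | .op _ x y => x.avoids A && y.avoids A

/-- This makes the rounds of a loop independent of one another: a body that does not read the array
being written depends only on the round number, which gives the loop a closed form. -/
theorem Expr.eval_congr {A : ℕ} {s s' : State} (hr : s.reg = s'.reg)
    (hm : ∀ a, a ≠ A → s.mem a = s'.mem a) (e : Expr) (he : e.avoids A = true) :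
    e.eval s = e.eval s' := by
  induction e with
  | const c => rfl
  | reg r => simp only [Expr.eval, hr]
  | load a i ih =>
    simp only [Expr.avoids, Bool.and_eq_true, decide_eq_true_eq] at he
    simp only [Expr.eval, ih he.2, hm a he.1]
  | op o x y ihx ihy =>
    simp only [Expr.avoids, Bool.and_eq_true] at he
    simp only [Expr.eval, ihx he.1, ihy he.2]

/-! ### Counting loops -/

/-- Execute `p` for all values of register `r` from `0` up to the content of register `N`. -/
def forLoop (r N : ℕ) (p : Cmd) : Cmd :=
  .seq (.assign r (.const 0)) (.loop (.op .lt (.reg r) (.reg N))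
    (.seq p (.assign r (.op .add (.reg r) (.const 1)))))

theorem State.ext_iff' {s s' : State} : s = s' ↔ s.reg = s'.reg ∧ s.mem = s'.mem := by
  cases s
  cases s'
  simp

@[simp] theorem State.mem_setReg (s : State) (r v : ℕ) : (s.setReg r v).mem = s.mem := rfl

/-- The states `st x` at the start of the rounds are prescribed in advance. Each round costs 4 for
the test and 4 for the increment besides the body; the 6 pays for the initialization and the last,
failing test. -/
theorem exec_forLoop {W r N T M : ℕ} {p : Cmd} {s : State} (st : ℕ → State)
    (hst : ∀ x ≤ M, (st x).reg r = x ∧ (st x).reg N = M) (h0 : st 0 = s.setReg r 0)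
    (hW : M + 1 < W)
    (hp : ∀ x < M, ∃ s', Exec W p (st x) T s' ∧ s'.reg r = x ∧ s'.setReg r (x + 1) = st (x + 1)) :
    Exec W (forLoop r N p) s (M * (T + 8) + 6) (st M) := by
  -- Induction on the number `j` of remaining rounds, because `Exec.loopStep` unfolds a loop at its
  -- front.
  have key : ∀ j ≤ M, Exec W (.loop (.op .lt (.reg r) (.reg N))
      (.seq p (.assign r (.op .add (.reg r) (.const 1))))) (st (M - j)) (j * (T + 8) + 4)
      (st M) := by
    intro j
    induction j with
    | zero =>
      intro _
      have h := hst M le_rfl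
      simp only [Nat.sub_zero, Nat.zero_mul, Nat.zero_add]
      refine Exec.loopDone _ _ _ ?_ ?_
      · simp only [Expr.Fits, h, Expr.eval, BinOp.eval]
        refine ⟨by omega, by omega, ?_⟩
        split_ifs <;> omega
      · simp [Expr.eval, BinOp.eval, h]
    | succ j ih =>
      intro hj
      obtain ⟨x, hx⟩ : ∃ x, x = M - (j + 1) := ⟨_, rfl⟩
      have hx' : M - j = x + 1 := by omega
      rw [hx'] at ih
      rw [← hx]
      have h := hst x (by omega)
      obtain ⟨s', hs', hr, he⟩ := hp x (by omega)
      have h2 : Exec W (.assign r (.op .add (.reg r) (.const 1))) s' 4 (st (x + 1)) := by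
        rw [← he, ← hr]
        refine Exec.assign s' r (.op .add (.reg r) (.const 1)) ?_
        simp only [Expr.Fits, Expr.eval, BinOp.eval, hr]
        omega
      have h3 := Exec.loopStep (.op .lt (.reg r) (.reg N)) _ _ _ _ _ _ (by
        simp only [Expr.Fits, h, Expr.eval, BinOp.eval]
        refine ⟨by omega, by omega, ?_⟩
        split_ifs <;> omega) (by
        simp only [Expr.eval, BinOp.eval, h]
        rw [if_pos (by omega)]
        exact one_ne_zero) (Exec.seq _ _ _ _ _ _ _ hs' h2) (ih (by omega))
      convert h3 using 1
      simp only [Expr.cost]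
      ring
  have h1 : Exec W (.assign r (.const 0)) s 2 (st 0) := by
    rw [h0]
    exact Exec.assign s r (.const 0) (by simp only [Expr.Fits]; omega)
  have h2 := key M le_rfl
  rw [Nat.sub_self] at h2
  have h3 := Exec.seq _ _ _ _ _ _ _ h1 h2
  have ht : 2 + (M * (T + 8) + 4) = M * (T + 8) + 6 := by omega
  rwa [ht] at h3

/-! ### Programs with counting loops -/

/-- Programs whose only loops are counting loops with a single assignment to an array as body. -/
inductive Prog where
  | assign (r : ℕ) (e : Expr)
  /-- for all `x` below register `N`, held in register `r`, increase `A[addr]` by `val` -/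
  | acc (r N A : ℕ) (addr val : Expr)
  /-- for all `x` below register `N`, held in register `r`, put `A[x] := val` -/
  | fill (r N A : ℕ) (val : Expr)
  | seq (p q : Prog)
  | cond (b : Expr) (p q : Prog)

def Prog.compile : Prog → Cmd
  | .assign r e => .assign r e
  | .acc r N A addr val => forLoop r N (.store A addr (.op .add (.load A addr) val))
  | .fill r N A val => forLoop r N (.store A (.reg r) val)
  | .seq p q => .seq p.compile q.compile
  | .cond b p q => .cond b p.compile q.compile

/-- The state of an accumulation loop after `x` rounds. -/
def accState (r A : ℕ) (addr val : Expr) (s : State) (x : ℕ) : State where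
  reg := Function.update s.reg r x
  mem := Function.update s.mem A fun a => s.mem A a + ∑ y ∈ Finset.range x,
    if addr.eval (s.setReg r y) = a then val.eval (s.setReg r y) else 0

/-- The state of a filling loop after `x` rounds. -/
def fillState (r A : ℕ) (val : Expr) (s : State) (x : ℕ) : State where
  reg := Function.update s.reg r x
  mem := Function.update s.mem A fun a =>
    if a < x then val.eval (s.setReg r a) else s.mem A a

/-- The state transformation performed by a program. -/
def Prog.sem : Prog → State → State
  | .assign r e, s => s.setReg r (e.eval s)
  | .acc r N A addr val, s => accState r A addr val s (s.reg N)
  | .fill r N A val, s => fillState r A val s (s.reg N)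
  | .seq p q, s => q.sem (p.sem s)
  | .cond b p q, s => if b.eval s ≠ 0 then p.sem s else q.sem s

/-- No loop of the program reads the array that it writes, and the number of rounds is at most
linear in `n ^ 3`. -/
def Prog.Ok (n : ℕ) : Prog → State → Prop
  | .assign _ _, _ => True
  | .acc r N A addr val, s =>
    r ≠ N ∧ addr.avoids A = true ∧ val.avoids A = true ∧ s.reg N ≤ 4 * (n ^ 3 + 1)
  | .fill r N A val, s => r ≠ N ∧ val.avoids A = true ∧ s.reg N ≤ 4 * (n ^ 3 + 1)
  | .seq p q, s => p.Ok n s ∧ q.Ok n (p.sem s)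
  | .cond b p q, s => if b.eval s ≠ 0 then p.Ok n s else q.Ok n s

/-- A cell receives fewer than `b ^ q` summands below `b ^ p` on top of its old content, so one loop
raises the exponent by an amount that does not depend on the input. -/
theorem accState_bounded {b q p M : ℕ} {r A : ℕ} {addr val : Expr} {s : State} (hb : 2 ≤ b)
    (hs : s.Bounded (b ^ q)) (hM : M < b ^ q)
    (hv : ∀ x ≤ M, val.eval (s.setReg r x) < b ^ p) {x : ℕ} (hx : x ≤ M) :
    (accState r A addr val s x).Bounded (b ^ (q + (q + p) + 1)) := by
  have hq : b ^ q ≤ b ^ (q + (q + p) + 1) := Nat.pow_le_pow_right (by omega) (by omega)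
  constructor
  · intro r'
    simp only [accState, Function.update_apply]
    split_ifs
    · omega
    · exact (hs.1 r').trans_le hq
  · intro a i
    simp only [accState, Function.update_apply]
    split_ifs
    · refine add_lt_pow_of_lt hb (hs.2 _ _) ?_
      calc _ ≤ ∑ y ∈ Finset.range x, b ^ p := by
            refine Finset.sum_le_sum fun y hy => ?_
            split_ifs
            · exact (hv y (by have := Finset.mem_range.1 hy; omega)).le
            · exact Nat.zero_le _
        _ = x * b ^ p := by simp
        _ < b ^ q * b ^ p := Nat.mul_lt_mul_of_pos_right (by omega) (by positivity)
        _ = b ^ (q + p) := (pow_add _ _ _).symm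
    · exact (hs.2 _ _).trans_le hq

theorem fillState_bounded {b q p M : ℕ} {r A : ℕ} {val : Expr} {s : State} (hb : 2 ≤ b)
    (hqp : q ≤ p) (hs : s.Bounded (b ^ q)) (hM : M < b ^ q)
    (hv : ∀ x ≤ M, val.eval (s.setReg r x) < b ^ p) {x : ℕ} (hx : x ≤ M) :
    (fillState r A val s x).Bounded (b ^ p) := by
  have hq : b ^ q ≤ b ^ p := Nat.pow_le_pow_right (by omega) hqp
  constructor
  · intro r'
    simp only [fillState, Function.update_apply]
    split_ifs
    · omega
    · exact (hs.1 r').trans_le hq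
  · intro a i
    simp only [fillState, Function.update_apply]
    split_ifs
    · beta_reduce
      split_ifs with hi
      · exact hv i (by omega)
      · exact (hs.2 _ _).trans_le hq
    · exact (hs.2 _ _).trans_le hq

theorem accState_eval {r A : ℕ} {addr val : Expr} {s : State} {x : ℕ} (e : Expr)
    (he : e.avoids A = true) : e.eval (accState r A addr val s x) = e.eval (s.setReg r x) :=
  Expr.eval_congr (s := accState r A addr val s x) (s' := s.setReg r x) rfl
    (fun a ha => by simp [accState, State.setReg, ha]) e he

theorem fillState_eval {r A : ℕ} {val : Expr} {s : State} {x : ℕ} (e : Expr)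
    (he : e.avoids A = true) : e.eval (fillState r A val s x) = e.eval (s.setReg r x) :=
  Expr.eval_congr (s := fillState r A val s x) (s' := s.setReg r x) rfl
    (fun a ha => by simp [fillState, State.setReg, ha]) e he

theorem exec_acc {W r N A : ℕ} {addr val : Expr} {s : State} (hr : r ≠ N)
    (ha : addr.avoids A = true) (hv : val.avoids A = true) (hW : s.reg N + 1 < W)
    (hfa : ∀ x < s.reg N, addr.Fits W (accState r A addr val s x))
    (hfv : ∀ x < s.reg N,
      (Expr.op .add (.load A addr) val).Fits W (accState r A addr val s x)) :
    Exec W (Prog.compile (.acc r N A addr val)) s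
      (s.reg N * (addr.cost + (addr.cost + 1 + val.cost + 1) + 1 + 8) + 6)
      (accState r A addr val s (s.reg N)) := by
  refine exec_forLoop (accState r A addr val s) (fun x _ => ?_) ?_ hW fun x hx => ?_
  · simp [accState, hr.symm]
  · simp [accState, State.setReg]
  · refine ⟨_, Exec.store _ _ _ _ (hfa x hx) (hfv x hx), by simp [State.setMem, accState], ?_⟩
    simp only [Expr.eval, accState_eval addr ha, accState_eval val hv, BinOp.eval]
    refine State.ext_iff'.2 ⟨by simp [accState, State.setMem, State.setReg], ?_⟩
    simp only [State.setMem, State.mem_setReg, accState, Function.update_idem,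
      Function.update_self]
    congr 1
    funext a
    rw [Finset.sum_range_succ]
    by_cases h : a = addr.eval (s.setReg r x)
    · rw [h, Function.update_self, if_pos rfl]
      exact add_assoc _ _ _
    · rw [Function.update_of_ne h, if_neg (Ne.symm h), add_zero]

theorem exec_fill {W r N A : ℕ} {val : Expr} {s : State} (hr : r ≠ N)
    (hv : val.avoids A = true) (hW : s.reg N + 1 < W)
    (hfv : ∀ x < s.reg N, val.Fits W (fillState r A val s x)) :
    Exec W (Prog.compile (.fill r N A val)) s
      (s.reg N * (1 + val.cost + 1 + 8) + 6) (fillState r A val s (s.reg N)) := by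
  refine exec_forLoop (fillState r A val s) (fun x _ => ?_) ?_ hW fun x hx => ?_
  · simp [fillState, hr.symm]
  · simp [fillState, State.setReg]
  · refine ⟨_, Exec.store _ _ _ _ ?_ (hfv x hx), by simp [State.setMem, fillState], ?_⟩
    · simp only [Expr.Fits, fillState, Function.update_self]
      omega
    simp only [Expr.eval, fillState_eval val hv]
    simp only [State.setMem, State.setReg, fillState, Function.update_idem, State.mk.injEq,
      true_and, Function.update_self]
    congr 1
    funext a
    simp only [Function.update_apply]
    by_cases h : a = x
    · simp [h]
    · have h' : a < x + 1 ↔ a < x := by omega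
      simp [h, h']

theorem rounds_time_le {N m : ℕ} (T : ℕ) (h : N ≤ 4 * (m + 1)) :
    N * T + 6 ≤ (4 * T + 6) * (m + 1) := by
  have := Nat.mul_le_mul_right T h
  nlinarith

/-- A program performs its state transformation within time `O(n ^ 3)`, and all numbers that occur
are bounded by a polynomial in the numbers of the initial state. -/
theorem Prog.exec_compile (p : Prog) (q : ℕ) : ∃ q' c, q ≤ q' ∧ ∀ n b s W, 2 ≤ b →
    p.Ok n s → s.Bounded (b ^ q) → b ^ q' ≤ W →
    (p.sem s).Bounded (b ^ q') ∧ ∃ t ≤ c * (n ^ 3 + 1), Exec W p.compile s t (p.sem s) := by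
  induction p generalizing q with
  | assign r e =>
    obtain ⟨q', hq, h⟩ := e.exists_bound q
    refine ⟨q', e.cost + 1, hq, fun n b s W hb _ hs hW => ⟨?_, _, ?_, Exec.assign s r e ?_⟩⟩
    · exact (hs.mono (Nat.pow_le_pow_right (by omega) hq)).setReg r (h b s hb hs).1
    · exact Nat.le_mul_of_pos_right _ (by omega)
    · exact (h b s hb hs).2 W hW
  | acc r N A addr val =>
    obtain ⟨p, hqp, hp⟩ := val.exists_bound q
    obtain ⟨p₁, h1, hp₁⟩ := addr.exists_bound (q + (q + p) + 1)
    obtain ⟨p₂, h2, hp₂⟩ := (Expr.op .add (.load A addr) val).exists_bound (q + (q + p) + 1)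
    refine ⟨p₁ + p₂ + 1, 4 * (addr.cost + (addr.cost + 1 + val.cost + 1) + 1 + 8) + 6, by omega,
      fun n b s W hb hok hs hW => ?_⟩
    obtain ⟨hr, ha, hv, hN⟩ := hok
    have hb' : ∀ x ≤ s.reg N, (accState r A addr val s x).Bounded (b ^ (q + (q + p) + 1)) :=
      fun x hx => accState_bounded hb hs (hs.1 N) (fun y hy =>
        (hp b _ hb (hs.setReg r (hy.trans_lt (hs.1 N)))).1) hx
    refine ⟨(hb' _ le_rfl).mono (Nat.pow_le_pow_right (by omega) (by omega)), _, ?_,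
      exec_acc hr ha hv ?_ (fun x hx => ?_) fun x hx => ?_⟩
    · exact rounds_time_le _ hN
    · have h1 : b ^ q < b ^ (p₁ + p₂ + 1) := Nat.pow_lt_pow_right (by omega) (by omega)
      have := hs.1 N
      omega
    · exact (hp₁ b _ hb (hb' x hx.le)).2 W
        ((Nat.pow_le_pow_right (by omega) (by omega)).trans hW)
    · exact (hp₂ b _ hb (hb' x hx.le)).2 W
        ((Nat.pow_le_pow_right (by omega) (by omega)).trans hW)
  | fill r N A val =>
    obtain ⟨p, hqp, hp⟩ := val.exists_bound q
    obtain ⟨p₁, h1, hp₁⟩ := val.exists_bound p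
    refine ⟨p₁ + 1, 4 * (1 + val.cost + 1 + 8) + 6, by omega, fun n b s W hb hok hs hW => ?_⟩
    obtain ⟨hr, hv, hN⟩ := hok
    have hb' : ∀ x ≤ s.reg N, (fillState r A val s x).Bounded (b ^ p) :=
      fun x hx => fillState_bounded hb hqp hs (hs.1 N) (fun y hy =>
        (hp b _ hb (hs.setReg r (hy.trans_lt (hs.1 N)))).1) hx
    refine ⟨(hb' _ le_rfl).mono (Nat.pow_le_pow_right (by omega) (by omega)), _, ?_,
      exec_fill hr hv ?_ fun x hx => ?_⟩
    · exact rounds_time_le _ hN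
    · have h1 : b ^ q < b ^ (p₁ + 1) := Nat.pow_lt_pow_right (by omega) (by omega)
      have := hs.1 N
      omega
    · exact (hp₁ b _ hb (hb' x hx.le)).2 W
        ((Nat.pow_le_pow_right (by omega) (by omega)).trans hW)
  | seq p₁ p₂ ih₁ ih₂ =>
    obtain ⟨q₁, c₁, h1, ih₁⟩ := ih₁ q
    obtain ⟨q₂, c₂, h2, ih₂⟩ := ih₂ q₁
    refine ⟨q₂, c₁ + c₂, by omega, fun n b s W hb hok hs hW => ?_⟩
    obtain ⟨hs₁, t₁, ht₁, he₁⟩ := ih₁ n b s W hb hok.1 hs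
      ((Nat.pow_le_pow_right (by omega) h2).trans hW)
    obtain ⟨hs₂, t₂, ht₂, he₂⟩ := ih₂ n b _ W hb hok.2 hs₁ hW
    exact ⟨hs₂, t₁ + t₂, by rw [add_mul]; omega, Exec.seq _ _ _ _ _ _ _ he₁ he₂⟩
  | cond e p₁ p₂ ih₁ ih₂ =>
    obtain ⟨q₁, c₁, h1, ih₁⟩ := ih₁ q
    obtain ⟨q₂, c₂, h2, ih₂⟩ := ih₂ q
    obtain ⟨q₃, h3, he⟩ := e.exists_bound q
    refine ⟨q₁ + q₂ + q₃, e.cost + 1 + c₁ + c₂, by omega, fun n b s W hb hok hs hW => ?_⟩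
    have hf := (he b s hb hs).2 W ((Nat.pow_le_pow_right (by omega) (by omega)).trans hW)
    have hpos : e.cost + 1 ≤ (e.cost + 1) * (n ^ 3 + 1) := Nat.le_mul_of_pos_right _ (by omega)
    by_cases h : e.eval s ≠ 0
    · simp only [Prog.Ok, if_pos h] at hok
      simp only [Prog.sem, if_pos h]
      obtain ⟨hs₁, t₁, ht₁, he₁⟩ := ih₁ n b s W hb hok hs
        ((Nat.pow_le_pow_right (by omega) (by omega)).trans hW)
      refine ⟨hs₁.mono (Nat.pow_le_pow_right (by omega) (by omega)), _, ?_,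
        Exec.condTrue e _ _ _ _ _ hf h he₁⟩
      rw [add_mul, add_mul]
      omega
    · simp only [Prog.Ok, if_neg h] at hok
      simp only [Prog.sem, if_neg h]
      obtain ⟨hs₁, t₁, ht₁, he₁⟩ := ih₂ n b s W hb hok hs
        ((Nat.pow_le_pow_right (by omega) (by omega)).trans hW)
      refine ⟨hs₁.mono (Nat.pow_le_pow_right (by omega) (by omega)), _, ?_,
        Exec.condFalse e _ _ _ _ _ hf (not_not.1 h) he₁⟩
      rw [add_mul, add_mul]
      omega

/-! ### Cluster graphs and closed adjacency -/

/-- `x` and `y` are equal or adjacent. -/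
def Cl {V : Type*} (G : SimpleGraph V) (x y : V) : Prop := x = y ∨ G.Adj x y

section Cl

variable {V : Type*} {G : SimpleGraph V} {x y z : V}

theorem Cl.refl (G : SimpleGraph V) (x : V) : Cl G x x := Or.inl rfl

theorem Cl.symm (h : Cl G x y) : Cl G y x := h.imp Eq.symm fun h => h.symm

theorem cl_comm : Cl G x y ↔ Cl G y x := ⟨Cl.symm, Cl.symm⟩

theorem adj_iff_cl : G.Adj x y ↔ x ≠ y ∧ Cl G x y :=
  ⟨fun h => ⟨h.ne, Or.inr h⟩, fun h => h.2.resolve_left h.1⟩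

theorem cl_comap_iff {W : Type*} (f : W ↪ V) (G : SimpleGraph V) (a b : W) :
    Cl (G.comap f) a b ↔ Cl G (f a) (f b) := by
  simp [Cl]

theorem IsClusterGraph.cl_trans (hG : IsClusterGraph G) (h₁ : Cl G x y) (h₂ : Cl G y z) :
    Cl G x z := by
  rcases h₁ with rfl | h₁
  · exact h₂
  rcases h₂ with rfl | h₂
  · exact Or.inr h₁
  by_contra h
  exact hG x y z ⟨h₁, h₂, fun e => h (Or.inl e), fun e => h (Or.inr e)⟩

/-- Closed adjacency is reflexive and symmetric in any graph, so this says that cluster graphs are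
those for which it is an equivalence relation. -/
theorem isClusterGraph_iff_cl_trans :
    IsClusterGraph G ↔ ∀ x y z, Cl G x y → Cl G y z → Cl G x z := by
  refine ⟨fun h x y z => h.cl_trans, fun h u v w ⟨h₁, h₂, hne, hn⟩ => ?_⟩
  exact (h u v w (Or.inr h₁) (Or.inr h₂)).elim hne hn

/-- The form that the program can test: it already knows which pairs have equal closed
neighborhoods. -/
theorem isClusterGraph_iff_cl_congr :
    IsClusterGraph G ↔ ∀ x y, G.Adj x y → ∀ z, Cl G x z ↔ Cl G y z := by
  refine ⟨fun h x y hxy z => ⟨h.cl_trans (Or.inr hxy.symm), h.cl_trans (Or.inr hxy)⟩,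
    fun h => isClusterGraph_iff_cl_trans.2 fun x y z hxy hyz => ?_⟩
  rcases hxy with rfl | hxy
  · exact hyz
  · exact (h x y hxy z).2 hyz

theorem IsClusterGraph.connectedComponentMk_eq_iff (hG : IsClusterGraph G) :
    G.connectedComponentMk x = G.connectedComponentMk y ↔ Cl G x y := by
  rw [SimpleGraph.ConnectedComponent.eq]
  constructor
  · rintro ⟨p⟩
    induction p with
    | nil => exact Cl.refl _ _
    | cons h _ ih => exact hG.cl_trans (Or.inr h) ih
  · rintro (rfl | h)
    · exact SimpleGraph.Reachable.refl _
    · exact h.reachable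

theorem IsClusterGraph.comap {W : Type*} (hG : IsClusterGraph G) (f : W ↪ V) :
    IsClusterGraph (G.comap f) :=
  fun u v w h => hG (f u) (f v) (f w) ⟨h.1, h.2.1, f.injective.ne h.2.2.1, h.2.2.2⟩

end Cl

/-! ### The two distances -/

-- Every vertex lies in exactly one intersection of a cluster of `G₁` with one of `G₂`, so the
-- weight counts the vertices whose pair of clusters is matched.
open Classical in
theorem matchingWeight_eq_card {V : Type*} [Fintype V] {G₁ G₂ : SimpleGraph V}
    (M : Finset (G₁.ConnectedComponent × G₂.ConnectedComponent)) :
    matchingWeight M = (Finset.univ.filter fun v : V =>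
      (G₁.connectedComponentMk v, G₂.connectedComponentMk v) ∈ M).card := by
  rw [Finset.card_eq_sum_card_fiberwise (t := M)
    (f := fun v => (G₁.connectedComponentMk v, G₂.connectedComponentMk v)) (by intro v; simp)]
  refine Finset.sum_congr rfl fun p hp => ?_
  rw [← Set.ncard_coe_finset]
  congr 1
  ext v
  simp only [Set.mem_inter_iff, SimpleGraph.ConnectedComponent.mem_supp_iff, Finset.coe_filter,
    Finset.mem_filter, Finset.mem_univ, true_and, Set.mem_ofPred_eq]
  constructor
  · rintro ⟨h₁, h₂⟩
    rw [h₁, h₂]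
    exact ⟨hp, rfl⟩
  · rintro ⟨-, rfl⟩
    exact ⟨rfl, rfl⟩

/-- Two cluster graphs have matching-based distance at most `d` if and only if they agree after
the deletion of at most `d` vertices. -/
theorem matchingDist_le_iff {V : Type*} [Fintype V] {G₁ G₂ : SimpleGraph V}
    (h₁ : IsClusterGraph G₁) (h₂ : IsClusterGraph G₂) (d : ℕ) :
    matchingDist G₁ G₂ ≤ d ↔
      ∃ D : Finset V, D.card ≤ d ∧ ∀ x ∉ D, ∀ y ∉ D, (G₁.Adj x y ↔ G₂.Adj x y) := by
  classical
  have hbdd : BddAbove {w : ℕ | ∃ M : Finset (G₁.ConnectedComponent × G₂.ConnectedComponent),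
      IsClusterMatching M ∧ matchingWeight M = w} := by
    refine ⟨Fintype.card V, ?_⟩
    rintro w ⟨M, -, rfl⟩
    rw [matchingWeight_eq_card]
    exact Finset.card_le_univ _
  constructor
  · intro h
    obtain ⟨M, hM, hw⟩ := Nat.sSup_mem (s := {w : ℕ |
        ∃ M : Finset (G₁.ConnectedComponent × G₂.ConnectedComponent),
          IsClusterMatching M ∧ matchingWeight M = w})
      ⟨0, ∅, by simp [IsClusterMatching], by simp [matchingWeight]⟩ hbdd
    -- The deleted vertices are those not covered by a maximum-weight matching. Two covered vertices
    -- share a cluster of `G₁` iff they share one of `G₂`, as matched pairs with a common endpoint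
    -- are equal.
    refine ⟨Finset.univ.filter fun v : V =>
      ¬ (G₁.connectedComponentMk v, G₂.connectedComponentMk v) ∈ M, ?_, ?_⟩
    · rw [matchingWeight_eq_card] at hw
      have h3 := Finset.card_filter_add_card_filter_not (s := (Finset.univ : Finset V))
        (fun v : V => (G₁.connectedComponentMk v, G₂.connectedComponentMk v) ∈ M)
      rw [Finset.card_univ] at h3
      unfold matchingDist maxMatchingWeight at h
      omega
    · intro x hx y hy
      simp only [Finset.mem_filter, Finset.mem_univ, true_and, not_not] at hx hy
      have := hM _ hx _ hy
      rw [Prod.mk.injEq, h₁.connectedComponentMk_eq_iff, h₂.connectedComponentMk_eq_iff] at this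
      rw [adj_iff_cl, adj_iff_cl]
      tauto
  · rintro ⟨D, hD, h⟩
    have hcl : ∀ x ∉ D, ∀ y ∉ D, (Cl G₁ x y ↔ Cl G₂ x y) := fun x hx y hy => by
      rw [Cl, Cl, h x hx y hy]
    -- Outside `D` the two cluster relations coincide, so the pairs of clusters of the vertices
    -- outside `D` form a matching, which covers all these vertices.
    let M : Finset (G₁.ConnectedComponent × G₂.ConnectedComponent) :=
      Dᶜ.image fun v => (G₁.connectedComponentMk v, G₂.connectedComponentMk v)
    have hM : IsClusterMatching M := by
      intro p hp q hq
      obtain ⟨x, hx, rfl⟩ := Finset.mem_image.1 hp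
      obtain ⟨y, hy, rfl⟩ := Finset.mem_image.1 hq
      rw [Finset.mem_compl] at hx hy
      have := hcl x hx y hy
      simp only [Prod.mk.injEq, h₁.connectedComponentMk_eq_iff, h₂.connectedComponentMk_eq_iff]
      tauto
    have hle : matchingWeight M ≤ maxMatchingWeight G₁ G₂ := le_csSup hbdd ⟨M, hM, rfl⟩
    rw [matchingWeight_eq_card] at hle
    have hsub : Dᶜ ⊆ Finset.univ.filter fun v : V =>
        (G₁.connectedComponentMk v, G₂.connectedComponentMk v) ∈ M := fun v hv =>
      Finset.mem_filter.2 ⟨Finset.mem_univ _, Finset.mem_image_of_mem _ hv⟩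
    have h4 := Finset.card_le_card hsub
    rw [Finset.card_compl] at h4
    unfold matchingDist
    omega

/-- The pair `x, y` is an edge of exactly one of the graphs. -/
def Differ {V : Type*} (G₁ G₂ : SimpleGraph V) (x y : V) : Prop := ¬ (G₁.Adj x y ↔ G₂.Adj x y)

section Differ

variable {V W : Type*} {G₁ G₂ : SimpleGraph V}

theorem mem_symmDiff_edgeSet {x y : V} :
    s(x, y) ∈ symmDiff G₁.edgeSet G₂.edgeSet ↔ Differ G₁ G₂ x y := by
  simp only [Set.mem_symmDiff, SimpleGraph.mem_edgeSet, Differ]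
  tauto

theorem edgeDist_le_of_exists [Finite W] {H₁ H₂ : SimpleGraph W} (f : W → V)
    (h : ∀ x y, Differ G₁ G₂ x y → ∃ a b, f a = x ∧ f b = y ∧ Differ H₁ H₂ a b) :
    edgeDist G₁ G₂ ≤ edgeDist H₁ H₂ := by
  have hsub : symmDiff G₁.edgeSet G₂.edgeSet ⊆
      Sym2.map f '' symmDiff H₁.edgeSet H₂.edgeSet := by
    intro e
    induction e with
    | _ x y =>
      intro he
      obtain ⟨a, b, rfl, rfl, hab⟩ := h x y (mem_symmDiff_edgeSet.1 he)
      exact ⟨s(a, b), mem_symmDiff_edgeSet.2 hab, rfl⟩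
  exact (Set.ncard_le_ncard hsub (Set.toFinite _)).trans (Set.ncard_image_le (Set.toFinite _))

theorem edgeDist_comap_le [Finite V] (f : W ↪ V) :
    edgeDist (G₁.comap f) (G₂.comap f) ≤ edgeDist G₁ G₂ := by
  unfold edgeDist
  rw [← Set.ncard_image_of_injective _ (Sym2.map.injective f.injective)]
  refine Set.ncard_le_ncard ?_ (Set.toFinite _)
  rintro _ ⟨e, he, rfl⟩
  induction e with
  | _ a b => exact mem_symmDiff_edgeSet.2 (mem_symmDiff_edgeSet.1 he)

-- The handshake lemma for the graph `H` of the differing pairs.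
open Classical in
theorem two_mul_edgeDist [Fintype V] (G₁ G₂ : SimpleGraph V) :
    2 * edgeDist G₁ G₂ = ∑ v, (Finset.univ.filter fun w => Differ G₁ G₂ v w).card := by
  let H : SimpleGraph V :=
    { Adj := Differ G₁ G₂
      symm := ⟨fun x y h => by simpa only [Differ, SimpleGraph.adj_comm] using h⟩
      loopless := ⟨fun x h => by simp [Differ] at h⟩ }
  have hH : symmDiff G₁.edgeSet G₂.edgeSet = H.edgeSet := by
    ext e
    induction e with
    | _ x y => exact mem_symmDiff_edgeSet
  have h := H.sum_degrees_eq_twice_card_edges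
  rw [edgeDist, hH, ← SimpleGraph.coe_edgeFinset, Set.ncard_coe_finset, ← h]
  refine Finset.sum_congr rfl fun v _ => ?_
  rw [← SimpleGraph.card_neighborFinset_eq_degree]
  congr 1
  ext w
  simp [H]

/-- Each differing pair has only two endpoints; hence k modifications touch at most 2k vertices. -/
theorem card_differ_le [Fintype V] {T : Finset V} (hT : ∀ v ∈ T, ∃ w, Differ G₁ G₂ v w) :
    T.card ≤ 2 * edgeDist G₁ G₂ := by
  classical
  rw [two_mul_edgeDist, Finset.card_eq_sum_ones]
  refine (Finset.sum_le_sum fun v hv => ?_).trans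
    (Finset.sum_le_sum_of_subset (Finset.subset_univ T))
  obtain ⟨w, hw⟩ := hT v hv
  exact Finset.card_pos.2 ⟨w, by simpa using hw⟩

theorem edgeDist_self (G : SimpleGraph V) : edgeDist G G = 0 := by
  simp [edgeDist]

theorem eq_of_edgeDist_eq_zero [Finite V] (h : edgeDist G₁ G₂ = 0) : G₁ = G₂ := by
  rw [edgeDist, Set.ncard_eq_zero (Set.toFinite _)] at h
  ext x y
  have h' := mem_symmDiff_edgeSet (G₁ := G₁) (G₂ := G₂) (x := x) (y := y)
  rw [h] at h'
  simpa [Differ] using h'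

end Differ

/-! ### Solutions of instances on arbitrary vertex sets -/

/-- The modification of a pair with adjacency `p` to adjacency `p'` is allowed. -/
def Modification.AllowsPair : Modification → Prop → Prop → Prop
  | .editing, _, _ => True
  | .deletion, p, p' => p' → p
  | .completion, p, p' => p → p'

theorem Modification.allowsPair_refl (m : Modification) (p : Prop) : m.AllowsPair p p := by
  cases m <;> simp [AllowsPair]

theorem Modification.allows_iff {V : Type*} (m : Modification) (G G' : SimpleGraph V) :
    m.Allows G G' ↔ ∀ x y, m.AllowsPair (G.Adj x y) (G'.Adj x y) := by
  cases m
  · simp [Allows, AllowsPair]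
  · simp only [Allows, AllowsPair, SimpleGraph.edgeSet_subset_edgeSet, SimpleGraph.le_iff_adj]
  · simp only [Allows, AllowsPair, SimpleGraph.edgeSet_subset_edgeSet, SimpleGraph.le_iff_adj]

/-- The cluster graph `G'` is a solution of the instance `(G, Gc, k, d)`. -/
def IsSolution {V : Type*} [Fintype V] (δ : Distance) (m : Modification) (G Gc : SimpleGraph V)
    (k d : ℕ) (G' : SimpleGraph V) : Prop :=
  IsClusterGraph G' ∧ m.Allows G G' ∧ edgeDist G G' ≤ k ∧ δ.dist G' Gc ≤ d

theorem IsSolution.comap {V W : Type*} [Fintype V] [Fintype W] {δ : Distance} {m : Modification}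
    {G Gc G' : SimpleGraph V} {k d : ℕ} (hGc : IsClusterGraph Gc)
    (h : IsSolution δ m G Gc k d G') (f : W ↪ V) :
    IsSolution δ m (G.comap f) (Gc.comap f) k d (G'.comap f) := by
  obtain ⟨hG', hm, hk, hd⟩ := h
  refine ⟨hG'.comap f, ?_, (edgeDist_comap_le f).trans hk, ?_⟩
  · rw [Modification.allows_iff] at hm ⊢
    exact fun x y => hm _ _
  · cases δ with
    | edge => exact (edgeDist_comap_le f).trans hd
    | matching =>
      obtain ⟨D, hD, h⟩ := (matchingDist_le_iff hG' hGc d).1 hd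
      refine (matchingDist_le_iff (hG'.comap f) (hGc.comap f) d).2
        ⟨D.preimage f f.injective.injOn, ?_, fun x hx y hy => ?_⟩
      · refine le_trans ?_ hD
        exact Finset.card_le_card_of_injOn f (fun x hx => Finset.mem_preimage.1 hx)
          f.injective.injOn
      · exact h _ (by simpa using hx) _ (by simpa using hy)

/-! ### Blowing up vertices and adding components -/

/-- Every vertex `x` with `φ x = some a` becomes a copy of the vertex `a` of `G'`, copies of the
same vertex are adjacent, and the vertices `x` with `φ x = none` induce the same graph as in `Gc`. -/
def blowUp {V W : Type*} (φ : V → Option W) (Gc : SimpleGraph V) (G' : SimpleGraph W) :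
    SimpleGraph V where
  Adj x y := x ≠ y ∧ ((∃ a b, φ x = some a ∧ φ y = some b ∧ Cl G' a b) ∨
    (φ x = none ∧ φ y = none ∧ Cl Gc x y))
  symm := ⟨by
    rintro x y ⟨hne, ⟨a, b, ha, hb, h⟩ | ⟨hx, hy, h⟩⟩
    · exact ⟨hne.symm, Or.inl ⟨b, a, hb, ha, h.symm⟩⟩
    · exact ⟨hne.symm, Or.inr ⟨hy, hx, h.symm⟩⟩⟩
  loopless := ⟨fun x h => h.1 rfl⟩

section BlowUp

variable {V W : Type*} {φ : V → Option W} {G Gc : SimpleGraph V} {G' : SimpleGraph W}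

theorem cl_blowUp_some {x y : V} {a b : W} (hx : φ x = some a) (hy : φ y = some b) :
    Cl (blowUp φ Gc G') x y ↔ Cl G' a b := by
  constructor
  · rintro (rfl | ⟨-, ⟨a', b', ha, hb, h⟩ | ⟨h, -⟩⟩)
    · rw [hx] at hy
      rw [Option.some.inj hy]
      exact Cl.refl _ _
    · rw [hx] at ha
      rw [hy] at hb
      rwa [Option.some.inj ha, Option.some.inj hb]
    · simp [hx] at h
  · intro h
    by_cases hxy : x = y
    · exact Or.inl hxy
    · exact Or.inr ⟨hxy, Or.inl ⟨a, b, hx, hy, h⟩⟩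

theorem cl_blowUp_none {x y : V} (hx : φ x = none) :
    Cl (blowUp φ Gc G') x y ↔ φ y = none ∧ Cl Gc x y := by
  constructor
  · rintro (rfl | ⟨-, ⟨a', b', ha, hb, h⟩ | ⟨-, h⟩⟩)
    · exact ⟨hx, Cl.refl _ _⟩
    · simp [hx] at ha
    · exact h
  · rintro ⟨hy, h⟩
    by_cases hxy : x = y
    · exact Or.inl hxy
    · exact Or.inr ⟨hxy, Or.inr ⟨hx, hy, h⟩⟩

theorem isClusterGraph_blowUp (hGc : IsClusterGraph Gc) (hG' : IsClusterGraph G') :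
    IsClusterGraph (blowUp φ Gc G') := by
  refine isClusterGraph_iff_cl_trans.2 fun x y z hxy hyz => ?_
  cases hx : φ x with
  | none =>
    obtain ⟨hy, h₁⟩ := (cl_blowUp_none hx).1 hxy
    obtain ⟨hz, h₂⟩ := (cl_blowUp_none hy).1 hyz
    exact (cl_blowUp_none hx).2 ⟨hz, hGc.cl_trans h₁ h₂⟩
  | some a =>
    cases hy : φ y with
    | none =>
      have := ((cl_blowUp_none hy).1 hxy.symm).1
      simp [hx] at this
    | some b =>
      cases hz : φ z with
      | none =>
        have := ((cl_blowUp_none hz).1 hyz.symm).1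
        simp [hy] at this
      | some c =>
        exact (cl_blowUp_some hx hz).2
          (hG'.cl_trans ((cl_blowUp_some hx hy).1 hxy) ((cl_blowUp_some hy hz).1 hyz))

end BlowUp

/-- Vertices that have the same closed neighborhood in `G` and lie in the same cluster of `Gc`. -/
def Twin {V : Type*} (G Gc : SimpleGraph V) (u v : V) : Prop :=
  (∀ w, Cl G u w ↔ Cl G v w) ∧ Cl Gc u v

/-- The map `φ` assigns to every vertex outside a union of common components of `G` and `Gc` a twin
in the range of `f`; vertices outside the range of `f` are assigned vertices at which `G'` does
not differ from the graph induced by `G`. -/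
structure IsRetraction {V W : Type*} (G Gc : SimpleGraph V) (f : W ↪ V) (G' : SimpleGraph W)
    (φ : V → Option W) : Prop where
  apply_range : ∀ a, φ (f a) = some a
  twin : ∀ x a, φ x = some a → Twin G Gc (f a) x
  untouched : ∀ x a, φ x = some a → x = f a ∨ ∀ b, ¬ Differ (G.comap f) G' a b
  not_differ : ∀ x, φ x = none → ∀ y, ¬ Differ G Gc x y
  none_of_cl : ∀ x y, φ x = none → Cl Gc x y → φ y = none

namespace IsRetraction

variable {V W : Type*} {G Gc : SimpleGraph V} {f : W ↪ V} {G' : SimpleGraph W} {φ : V → Option W}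

theorem cl_iff_of_none (h : IsRetraction G Gc f G' φ) {x : V} (hx : φ x = none) (y : V) :
    (Cl (blowUp φ Gc G') x y ↔ Cl Gc x y) ∧ (Cl (blowUp φ Gc G') x y ↔ Cl G x y) := by
  have h1 : Cl (blowUp φ Gc G') x y ↔ Cl Gc x y :=
    (cl_blowUp_none hx).trans ⟨And.right, fun hy => ⟨h.none_of_cl x y hx hy, hy⟩⟩
  have h2 := not_not.1 (h.not_differ x hx y)
  refine ⟨h1, h1.trans ?_⟩
  rw [Cl, Cl, h2]

/-- Exchange the endpoints for their twins one at a time, using symmetry in between. -/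
theorem twin_cl_iff (h : IsRetraction G Gc f G' φ) {x y : V} {a b : W} (hx : φ x = some a)
    (hy : φ y = some b) : Cl (G.comap f) a b ↔ Cl G x y := by
  rw [cl_comap_iff, (h.twin x a hx).1, cl_comm, (h.twin y b hy).1, cl_comm]

/-- A vertex outside the range either belongs to a common component or copies a vertex that `G'`
leaves untouched; in both cases its closed neighborhood stays that of `G`. -/
theorem cl_iff (h : IsRetraction G Gc f G' φ) {x : V} (hx : x ∉ Set.range f) (y : V) :
    Cl (blowUp φ Gc G') x y ↔ Cl G x y := by
  cases hx' : φ x with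
  | none => exact (h.cl_iff_of_none hx' y).2
  | some a =>
    cases hy : φ y with
    | none =>
      rw [cl_comm, cl_comm (G := G)]
      exact (h.cl_iff_of_none hy x).2
    | some b =>
      rw [cl_blowUp_some hx' hy, ← h.twin_cl_iff hx' hy]
      have := ((h.untouched x a hx').resolve_left fun e => hx ⟨a, e.symm⟩) b
      rw [Differ, not_not] at this
      rw [Cl, Cl, this]

/-- By `cl_iff` both endpoints of a modified pair lie in the range of `f`, so inserting copies needs
no new modification. -/
theorem differ_left (h : IsRetraction G Gc f G' φ) {x y : V}
    (hxy : Differ G (blowUp φ Gc G') x y) :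
    ∃ a b, f a = x ∧ f b = y ∧ Differ (G.comap f) G' a b := by
  have key : ∀ {x y : V}, Differ G (blowUp φ Gc G') x y → ∃ a, f a = x := fun {x y} hxy => by
    by_contra hx
    have := h.cl_iff (x := x) hx y
    exact hxy (by rw [adj_iff_cl, adj_iff_cl, this])
  obtain ⟨a, rfl⟩ := key hxy
  obtain ⟨b, rfl⟩ := key (x := y) (y := f a) fun e => hxy (by
    rw [G.adj_comm, SimpleGraph.adj_comm (blowUp φ Gc G')]
    exact e)
  refine ⟨a, b, rfl, rfl, fun e => hxy ?_⟩
  rw [adj_iff_cl, adj_iff_cl, cl_blowUp_some (h.apply_range a) (h.apply_range b),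
    f.injective.ne_iff, ← cl_comap_iff, ← adj_iff_cl, ← adj_iff_cl]
  exact e

theorem allows (h : IsRetraction G Gc f G' φ) {m : Modification} (hm : m.Allows (G.comap f) G') :
    m.Allows G (blowUp φ Gc G') := by
  rw [Modification.allows_iff] at hm ⊢
  intro x y
  by_cases hxy : Differ G (blowUp φ Gc G') x y
  · obtain ⟨a, b, rfl, rfl, -⟩ := h.differ_left hxy
    have h1 : (blowUp φ Gc G').Adj (f a) (f b) ↔ G'.Adj a b := by
      rw [adj_iff_cl, adj_iff_cl, cl_blowUp_some (h.apply_range a) (h.apply_range b),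
        f.injective.ne_iff]
    rw [h1]
    exact hm a b
  · rw [← not_not.1 hxy]
    exact m.allowsPair_refl _

theorem edgeDist_le [Finite W] (h : IsRetraction G Gc f G' φ) :
    edgeDist G (blowUp φ Gc G') ≤ edgeDist (G.comap f) G' :=
  edgeDist_le_of_exists f fun _ _ hxy => h.differ_left hxy

/-- The hypothesis `hr` is the reason for keeping the bad vertices in the edge-based problems: a
discarded bad vertex would contribute differences to `Gc` that the reduced instance does not count.
-/
theorem edgeDist_le_right [Finite W] (h : IsRetraction G Gc f G' φ)
    (hr : ∀ x ∉ Set.range f, ∀ y, ¬ Differ G Gc x y) :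
    edgeDist (blowUp φ Gc G') Gc ≤ edgeDist G' (Gc.comap f) := by
  refine edgeDist_le_of_exists f fun x y hxy => ?_
  have key : ∀ {x y : V}, Differ (blowUp φ Gc G') Gc x y → ∃ a, f a = x := fun {x y} hxy => by
    by_contra hx
    have h1 := h.cl_iff (x := x) hx y
    have h2 := not_not.1 (hr x hx y)
    exact hxy (by rw [adj_iff_cl, h1, ← adj_iff_cl, h2])
  obtain ⟨a, rfl⟩ := key hxy
  obtain ⟨b, rfl⟩ := key (x := y) (y := f a) fun e => hxy (by
    rw [Gc.adj_comm, SimpleGraph.adj_comm (blowUp φ Gc G')]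
    exact e)
  refine ⟨a, b, rfl, rfl, fun e => hxy ?_⟩
  rw [adj_iff_cl, cl_blowUp_some (h.apply_range a) (h.apply_range b),
    f.injective.ne_iff, ← adj_iff_cl]
  exact e

/-- Copies lie in the same cluster of `Gc` as their originals, and vertices of `D` are never copied,
so deleting `D` still suffices. -/
theorem matchingDist_le [Fintype V] [Fintype W] (h : IsRetraction G Gc f G' φ)
    (hGc : IsClusterGraph Gc) (hG' : IsClusterGraph G') {D : Finset W}
    (hD : ∀ a ∉ D, ∀ b ∉ D, (G'.Adj a b ↔ (Gc.comap f).Adj a b))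
    (hφ : ∀ x a, φ x = some a → x = f a ∨ a ∉ D) :
    matchingDist (blowUp φ Gc G') Gc ≤ D.card := by
  refine (matchingDist_le_iff (isClusterGraph_blowUp hGc hG') hGc _).2
    ⟨D.map f, by simp, fun x hx y hy => ?_⟩
  have key : ∀ x ∉ D.map f, ∀ a, φ x = some a → a ∉ D := fun x hx a ha haD => by
    rcases hφ x a ha with rfl | h
    · exact hx (Finset.mem_map_of_mem _ haD)
    · exact h haD
  suffices Cl (blowUp φ Gc G') x y ↔ Cl Gc x y by rw [adj_iff_cl, adj_iff_cl, this]
  cases hx' : φ x with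
  | none => exact (h.cl_iff_of_none hx' y).1
  | some a =>
    cases hy' : φ y with
    | none =>
      rw [cl_comm, cl_comm (G := Gc)]
      exact (h.cl_iff_of_none hy' x).1
    | some b =>
      rw [cl_blowUp_some hx' hy', Cl, hD a (key x hx a hx') b (key y hy b hy'), ← Cl,
        cl_comap_iff]
      have h1 := (h.twin x a hx').2
      have h2 := (h.twin y b hy').2
      exact ⟨fun e => hGc.cl_trans h1.symm (hGc.cl_trans e h2),
        fun e => hGc.cl_trans h1 (hGc.cl_trans e h2.symm)⟩

end IsRetraction

/-! ### Bad vertices, common components, and kept vertices -/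

/-- The vertex `v` has different neighborhoods in `G` and `Gc`. -/
def Bad {V : Type*} (G Gc : SimpleGraph V) (v : V) : Prop := ∃ w, Differ G Gc v w

/-- No vertex of the cluster of `v` in `Gc` is bad; then this cluster is a component of `G`. -/
def Common {V : Type*} (G Gc : SimpleGraph V) (v : V) : Prop := ∀ w, Cl Gc v w → ¬ Bad G Gc w

/-- The number of twins beyond which a vertex is superfluous. -/
def Distance.threshold : Distance → ℕ → ℕ → ℕ
  | .matching, k, d => 2 * k + d + 1
  | .edge, k, _ => 2 * k + 1

open Classical in
/-- The set of the twins of `v` that precede `v`. -/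
noncomputable def prevTwins {n : ℕ} (G Gc : SimpleGraph (Fin n)) (v : Fin n) : Finset (Fin n) :=
  Finset.univ.filter fun u => u < v ∧ Twin G Gc u v

theorem mem_prevTwins {n : ℕ} {G Gc : SimpleGraph (Fin n)} {u v : Fin n} :
    u ∈ prevTwins G Gc v ↔ u < v ∧ Twin G Gc u v := by
  simp [prevTwins]

open Classical in
/-- The vertices that are kept by the kernelization. -/
noncomputable def keptSet {n : ℕ} (δ : Distance) (G Gc : SimpleGraph (Fin n)) (k d : ℕ) :
    Finset (Fin n) :=
  Finset.univ.filter fun v => ¬ Common G Gc v ∧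
    ((δ = .edge ∧ Bad G Gc v) ∨ (prevTwins G Gc v).card < δ.threshold k d)

section Twin

variable {V : Type*} {G Gc : SimpleGraph V} {u v w : V}

theorem Twin.refl (G Gc : SimpleGraph V) (v : V) : Twin G Gc v v :=
  ⟨fun _ => Iff.rfl, Cl.refl _ _⟩

theorem Twin.trans (hGc : IsClusterGraph Gc) (h₁ : Twin G Gc u v) (h₂ : Twin G Gc v w) :
    Twin G Gc u w :=
  ⟨fun z => (h₁.1 z).trans (h₂.1 z), hGc.cl_trans h₁.2 h₂.2⟩

theorem Common.of_cl (hGc : IsClusterGraph Gc) (h : Common G Gc u) (huv : Cl Gc u v) :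
    Common G Gc v :=
  fun w hw => h w (hGc.cl_trans huv hw)

theorem not_bad_iff : ¬ Bad G Gc v ↔ ∀ w, (Cl G v w ↔ Cl Gc v w) := by
  simp only [Bad, Differ, not_exists, not_not]
  refine forall_congr' fun w => ⟨fun h => by rw [Cl, Cl, h], fun h => by
    rw [adj_iff_cl, adj_iff_cl, h]⟩

end Twin

/-- If some preceding twin itself has at least `L` preceding twins, pass to it, since its preceding
twins also precede `v`; otherwise the filter removes nothing. Thus a discarded vertex has `L` twins
that survive the twin rule. -/
theorem le_card_prevTwins_filter {n : ℕ} {G Gc : SimpleGraph (Fin n)} (hGc : IsClusterGraph Gc)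
    (L : ℕ) (v : Fin n) (hv : L ≤ (prevTwins G Gc v).card) :
    L ≤ ((prevTwins G Gc v).filter fun u => (prevTwins G Gc u).card < L).card := by
  induction v using WellFoundedLT.induction with
  | _ v ih =>
    by_cases h : ∃ u ∈ prevTwins G Gc v, L ≤ (prevTwins G Gc u).card
    · obtain ⟨u, hu, hL⟩ := h
      rw [mem_prevTwins] at hu
      refine (ih u hu.1 hL).trans (Finset.card_le_card fun w hw => ?_)
      rw [Finset.mem_filter, mem_prevTwins] at hw ⊢
      exact ⟨⟨hw.1.1.trans hu.1, hw.1.2.trans hGc hu.2⟩, hw.2⟩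
    · push Not at h
      rwa [Finset.filter_true_of_mem h]

/-- All other elements of `A` are preceding twins of its last element. -/
theorem card_le_of_pairwise_twin {n L : ℕ} {G Gc : SimpleGraph (Fin n)} {A : Finset (Fin n)}
    (hA : ∀ x ∈ A, ∀ y ∈ A, Twin G Gc x y) (hL : ∀ x ∈ A, (prevTwins G Gc x).card < L) :
    A.card ≤ L := by
  rcases A.eq_empty_or_nonempty with rfl | hne
  · simp
  have hmax := A.max'_mem hne
  have hsub : A.erase (A.max' hne) ⊆ prevTwins G Gc (A.max' hne) := fun x hx => by
    have hxA := Finset.mem_of_mem_erase hx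
    rw [mem_prevTwins]
    exact ⟨lt_of_le_of_ne (A.le_max' x hxA) (Finset.ne_of_mem_erase hx), hA _ hxA _ hmax⟩
  have h1 := Finset.card_le_card hsub
  rw [Finset.card_erase_of_mem hmax] at h1
  have := hL _ hmax
  omega

/-- A set of vertices that is covered by a set `T` and, for each element of `T`, some sets of at
most `L` vertices. -/
theorem card_le_of_cover {V : Type*} [DecidableEq V] {S T : Finset V} {L : ℕ}
    (A : V → Finset V) (hA : ∀ t ∈ T, (A t).card ≤ L)
    (h : ∀ x ∈ S, x ∉ T → ∃ t ∈ T, x ∈ A t) : S.card ≤ T.card + T.card * L := by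
  have hsub : S ⊆ T ∪ T.biUnion A := fun x hx => by
    by_cases hT : x ∈ T
    · exact Finset.mem_union_left _ hT
    · exact Finset.mem_union_right _ (Finset.mem_biUnion.2 (h x hx hT))
  calc S.card ≤ (T ∪ T.biUnion A).card := Finset.card_le_card hsub
    _ ≤ T.card + (T.biUnion A).card := Finset.card_union_le _ _
    _ ≤ T.card + T.card * L := by gcongr; exact Finset.card_biUnion_le_card_mul _ _ _ hA

/-- In an instance of an edge-based problem whose two graphs have small distance, few vertices are
kept. -/
theorem card_keptSet_edge {n k d : ℕ} {G Gc : SimpleGraph (Fin n)} (hGc : IsClusterGraph Gc)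
    (h : edgeDist G Gc ≤ k + d) :
    (keptSet .edge G Gc k d).card ≤ 2 * (k + d) + 2 * (k + d) * (2 * k + 1) := by
  classical
  let T : Finset (Fin n) := Finset.univ.filter fun v => Bad G Gc v
  have hT₀ : T.card ≤ 2 * edgeDist G Gc :=
    card_differ_le fun v hv => (Finset.mem_filter.1 hv).2
  have hT : T.card ≤ 2 * (k + d) := by omega
  let A : Fin n → Finset (Fin n) := fun t =>
    (keptSet .edge G Gc k d).filter fun x => ¬ Bad G Gc x ∧ Cl Gc x t
  have hle : (keptSet .edge G Gc k d).card ≤ T.card + T.card * (2 * k + 1) := by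
    refine card_le_of_cover A (fun t _ => ?_) fun x hx hxT => ?_
    · refine card_le_of_pairwise_twin (G := G) (Gc := Gc) (fun x hx y hy => ?_) fun x hx => ?_
      · simp only [A, Finset.mem_filter] at hx hy
        have hxy := hGc.cl_trans hx.2.2 hy.2.2.symm
        refine ⟨fun w => ?_, hxy⟩
        rw [not_bad_iff.1 hx.2.1, not_bad_iff.1 hy.2.1]
        exact ⟨hGc.cl_trans hxy.symm, hGc.cl_trans hxy⟩
      · obtain ⟨hx, hb, -⟩ := Finset.mem_filter.1 hx
        exact ((Finset.mem_filter.1 hx).2.2).resolve_left fun e => hb e.2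
    · have hb : ¬ Bad G Gc x := by simpa [T] using hxT
      have hc : ¬ Common G Gc x := by
        simp only [keptSet, Finset.mem_filter] at hx
        exact hx.2.1
      simp only [Common, not_forall, not_not] at hc
      obtain ⟨t, hxt, ht⟩ := hc
      exact ⟨t, by simpa [T] using ht, Finset.mem_filter.2 ⟨hx, hb, hxt⟩⟩
  exact hle.trans (Nat.add_le_add hT (Nat.mul_le_mul_right _ hT))

/-- In a yes-instance of a matching-based problem, few vertices are kept. -/
theorem card_keptSet_matching {n k d : ℕ} {G Gc G' : SimpleGraph (Fin n)}
    (hGc : IsClusterGraph Gc) {m : Modification} (h : IsSolution .matching m G Gc k d G') :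
    (keptSet .matching G Gc k d).card ≤
      (2 * k + d) + (2 * k + d) * (2 * (2 * k + d + 1)) := by
  classical
  obtain ⟨hG', -, hk, hd⟩ := h
  obtain ⟨D, hD, hDG⟩ := (matchingDist_le_iff hG' hGc d).1 hd
  -- Outside `T` closed neighborhoods in `G` and `G'` are equal, and `G'` agrees with `Gc` on pairs.
  let T : Finset (Fin n) := (Finset.univ.filter fun v => ∃ w, Differ G G' v w) ∪ D
  have hT : T.card ≤ 2 * k + d := by
    refine (Finset.card_union_le _ _).trans (Nat.add_le_add ?_ hD)
    exact (card_differ_le fun v hv => (Finset.mem_filter.1 hv).2).trans (Nat.mul_le_mul_left 2 hk)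
  have hG : ∀ x ∉ T, ∀ y, (Cl G x y ↔ Cl G' x y) := fun x hx => by
    simp only [T, Finset.mem_union, Finset.mem_filter, Finset.mem_univ, true_and, not_or] at hx
    exact not_bad_iff.1 hx.1
  have hc : ∀ x ∉ T, ∀ y ∉ T, (Cl G' x y ↔ Cl Gc x y) := fun x hx y hy => by
    simp only [T, Finset.mem_union, not_or] at hx hy
    rw [Cl, Cl, hDG x hx.2 y hy.2]
  let A : SimpleGraph (Fin n) → Fin n → Finset (Fin n) := fun H t =>
    (keptSet .matching G Gc k d).filter fun x => x ∉ T ∧ Cl H x t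
  have hA : ∀ H, IsClusterGraph H → (∀ x ∉ T, ∀ y ∉ T, (Cl H x y ↔ Cl Gc x y)) →
      ∀ t, (A H t).card ≤ 2 * k + d + 1 := fun H hH hHc t => by
    refine card_le_of_pairwise_twin (G := G) (Gc := Gc) (fun x hx y hy => ?_) fun x hx => ?_
    · simp only [A, Finset.mem_filter] at hx hy
      have hxy := (hHc x hx.2.1 y hy.2.1).1 (hH.cl_trans hx.2.2 hy.2.2.symm)
      have hxy' := (hc x hx.2.1 y hy.2.1).2 hxy
      refine ⟨fun w => ?_, hxy⟩
      rw [hG x hx.2.1, hG y hy.2.1]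
      exact ⟨hG'.cl_trans hxy'.symm, hG'.cl_trans hxy'⟩
    · simp only [A, keptSet, Finset.mem_filter, Finset.mem_univ, true_and] at hx
      exact hx.1.2.resolve_left fun e => by simp at e
  have hle : (keptSet .matching G Gc k d).card ≤ T.card + T.card * (2 * (2 * k + d + 1)) := by
    refine card_le_of_cover (fun t => A Gc t ∪ A G' t) (fun t _ => ?_) fun x hx hxT => ?_
    · refine (Finset.card_union_le _ _).trans ?_
      have h1 := hA Gc hGc (fun _ _ _ _ => Iff.rfl) t
      have h2 := hA G' hG' hc t
      omega
    · have hcom : ¬ Common G Gc x := by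
        simp only [keptSet, Finset.mem_filter] at hx
        exact hx.2.1
      -- If neither the `Gc`-cluster nor the `G'`-cluster of `x` met `T`, the two would coincide and
      -- contain no bad vertex, so `x` would have been discarded as common.
      by_contra hno
      push Not at hno
      have hT₁ : ∀ t, Cl Gc x t → t ∉ T := fun t hxt htT =>
        hno t htT (Finset.mem_union_left _ (Finset.mem_filter.2 ⟨hx, hxT, hxt⟩))
      have hT₂ : ∀ t, Cl G' x t → t ∉ T := fun t hxt htT =>
        hno t htT (Finset.mem_union_right _ (Finset.mem_filter.2 ⟨hx, hxT, hxt⟩))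
      refine hcom fun w hw => not_bad_iff.2 fun z => ?_
      have hwT := hT₁ w hw
      have hw' := (hc x hxT w hwT).2 hw
      rw [hG w hwT]
      constructor
      · exact fun hz => (hc w hwT z (hT₂ z (hG'.cl_trans hw' hz))).1 hz
      · exact fun hz => (hc w hwT z (hT₁ z (hGc.cl_trans hw hz))).2 hz
  exact hle.trans (Nat.add_le_add hT (Nat.mul_le_mul_right _ hT))

/-! ### Correctness of the reduction -/

/-- A solution on the kept vertices can be extended to all vertices. -/
theorem exists_solution_of_keptSet {n : ℕ} {W : Type*} [Fintype W] {δ : Distance}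
    {m : Modification} {G Gc : SimpleGraph (Fin n)} {k d : ℕ} (hGc : IsClusterGraph Gc)
    (f : W ↪ Fin n) (hf : ∀ v, v ∈ Set.range f ↔ v ∈ keptSet δ G Gc k d) {G' : SimpleGraph W}
    (h : IsSolution δ m (G.comap f) (Gc.comap f) k d G') :
    ∃ G'', IsSolution δ m G Gc k d G'' := by
  classical
  obtain ⟨hG', hm, hk, hd⟩ := h
  -- For the edge distance `D` plays no role and is empty, which lets one counting argument serve
  -- both thresholds.
  obtain ⟨D, hDL, hDm⟩ : ∃ D : Finset W, 2 * k + D.card < δ.threshold k d ∧ (δ = .matching →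
      D.card ≤ d ∧ ∀ a ∉ D, ∀ b ∉ D, (G'.Adj a b ↔ (Gc.comap f).Adj a b)) := by
    cases δ with
    | edge => exact ⟨∅, by simp [Distance.threshold], by simp⟩
    | matching =>
      obtain ⟨D, hD, h⟩ := (matchingDist_le_iff hG' (hGc.comap f) d).1 hd
      exact ⟨D, by simp only [Distance.threshold]; omega, fun _ => ⟨hD, h⟩⟩
  have hnc : ∀ a, ¬ Common G Gc (f a) := fun a => by
    have := (hf (f a)).1 ⟨a, rfl⟩
    simp only [keptSet, Finset.mem_filter] at this
    exact this.2.1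
  have hex : ∀ x, ∃ o : Option W, (Common G Gc x ∧ o = none) ∨ (¬ Common G Gc x ∧ ∃ a, o = some a ∧
      Twin G Gc (f a) x ∧ (x = f a ∨
        (x ∉ Set.range f ∧ (∀ b, ¬ Differ (G.comap f) G' a b) ∧ a ∉ D))) := by
    intro x
    by_cases hc : Common G Gc x
    · exact ⟨none, Or.inl ⟨hc, rfl⟩⟩
    by_cases hx : x ∈ Set.range f
    · obtain ⟨a, rfl⟩ := hx
      exact ⟨some a, Or.inr ⟨hc, a, rfl, Twin.refl _ _ _, Or.inl rfl⟩⟩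
    have hL : δ.threshold k d ≤ (prevTwins G Gc x).card := by
      have := mt (hf x).2 hx
      simp only [keptSet, Finset.mem_filter, Finset.mem_univ, true_and, not_and, not_or,
        not_lt] at this
      exact (this hc).2
    have hL' := le_card_prevTwins_filter hGc _ _ hL
    -- `X` collects what must not be copied: the vertices touched by modifications, and `D`. It is
    -- smaller than the threshold, so some kept twin of `x` avoids it.
    let X : Finset W := (Finset.univ.filter fun a => ∃ b, Differ (G.comap f) G' a b) ∪ D
    have hX : X.card ≤ 2 * k + D.card := by
      refine (Finset.card_union_le _ _).trans (Nat.add_le_add_right ?_ _)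
      exact (card_differ_le fun v hv => (Finset.mem_filter.1 hv).2).trans (Nat.mul_le_mul_left 2 hk)
    obtain ⟨u, hu, huX⟩ := Finset.exists_mem_notMem_of_card_lt_card
      (s := X.map f) (t := (prevTwins G Gc x).filter fun u =>
        (prevTwins G Gc u).card < δ.threshold k d) (by rw [Finset.card_map]; omega)
    rw [Finset.mem_filter, mem_prevTwins] at hu
    have huk : u ∈ keptSet δ G Gc k d := by
      simp only [keptSet, Finset.mem_filter, Finset.mem_univ, true_and]
      exact ⟨fun h => hc (h.of_cl hGc hu.1.2.2), Or.inr hu.2⟩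
    obtain ⟨a, rfl⟩ := (hf u).2 huk
    have ha : a ∉ X := fun h => huX (Finset.mem_map_of_mem _ h)
    simp only [X, Finset.mem_union, Finset.mem_filter, Finset.mem_univ, true_and, not_or,
      not_exists] at ha
    exact ⟨some a, Or.inr ⟨hc, a, rfl, hu.1.2, Or.inr ⟨hx, ha⟩⟩⟩
  choose φ hφ using hex
  have hnone : ∀ x, φ x = none ↔ Common G Gc x := fun x => by
    rcases hφ x with h | ⟨h, a, ha, -⟩
    · exact ⟨fun _ => h.1, fun _ => h.2⟩
    · simp [ha, h]
  have hsome : ∀ x a, φ x = some a → Twin G Gc (f a) x ∧ (x = f a ∨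
        (x ∉ Set.range f ∧ (∀ b, ¬ Differ (G.comap f) G' a b) ∧ a ∉ D)) := fun x a ha => by
    rcases hφ x with h | ⟨-, b, hb, h⟩
    · simp [h.2] at ha
    · rw [hb] at ha
      rwa [← Option.some.inj ha]
  have hR : IsRetraction G Gc f G' φ := by
    refine ⟨fun a => ?_, fun x a ha => (hsome x a ha).1,
      fun x a ha => (hsome x a ha).2.imp_right fun h => h.2.1, fun x hx y hxy => ?_,
      fun x y hx hxy => (hnone y).2 (((hnone x).1 hx).of_cl hGc hxy)⟩
    · cases h : φ (f a) with
      | none => exact absurd ((hnone _).1 h) (hnc a)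
      | some b =>
        rcases (hsome _ b h).2 with h | ⟨h, -⟩
        · rw [f.injective h]
        · exact absurd ⟨a, rfl⟩ h
    · exact (hnone x).1 hx x (Cl.refl _ _) ⟨y, hxy⟩
  refine ⟨blowUp φ Gc G', isClusterGraph_blowUp hGc hG', hR.allows hm, hR.edgeDist_le.trans hk, ?_⟩
  cases δ with
  | edge =>
    refine (hR.edgeDist_le_right fun x hx y hxy => ?_).trans hd
    have hx' := mt (hf x).2 hx
    simp only [keptSet, Finset.mem_filter, Finset.mem_univ, true_and, not_and, not_or] at hx'
    by_cases hc : Common G Gc x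
    · exact hc x (Cl.refl _ _) ⟨y, hxy⟩
    · exact (hx' hc).1 ⟨y, hxy⟩
  | matching =>
    obtain ⟨hDd, hDG⟩ := hDm rfl
    exact (hR.matchingDist_le hGc hG' hDG fun x a ha =>
      (hsome x a ha).2.imp_right fun h => h.2.2).trans hDd

/-! ### Sums over matrix positions -/

theorem mul_add_div_fin {n : ℕ} (a : ℕ) (w : Fin n) : (a * n + w) / n = a := by
  have := w.pos
  rw [mul_comm, Nat.mul_add_div this, Nat.div_eq_of_lt w.isLt, add_zero]

theorem mul_add_mod_fin {n : ℕ} (a : ℕ) (w : Fin n) : (a * n + w) % n = w := by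
  rw [mul_comm, Nat.mul_add_mod, Nat.mod_eq_of_lt w.isLt]

theorem mul_add_lt_mul {m n : ℕ} (u : Fin m) (v : Fin n) : (u : ℕ) * n + v < m * n := by
  have h := Nat.mul_le_mul_right n (Nat.succ_le_of_lt u.isLt)
  have := v.isLt
  rw [Nat.succ_mul] at h
  omega

/-- The flattening of nested loops: one counter encodes a row and a column, recovered as quotient
and remainder. -/
theorem sum_range_mul_eq (m n : ℕ) (g : ℕ → ℕ) :
    ∑ x ∈ Finset.range (m * n), g x = ∑ u : Fin m, ∑ w : Fin n, g (u * n + w) := by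
  rw [Finset.sum_range, ← finProdFinEquiv.sum_comp, Fintype.sum_prod_type]
  refine Finset.sum_congr rfl fun u _ => Finset.sum_congr rfl fun w _ => ?_
  rw [finProdFinEquiv_apply_val, add_comm, mul_comm]

theorem sum_range_mul_div {m n a : ℕ} (ha : a < m) (g : ℕ → ℕ) :
    ∑ x ∈ Finset.range (m * n), (if x / n = a then g x else 0) =
      ∑ w : Fin n, g (a * n + w) := by
  rw [sum_range_mul_eq, Fintype.sum_eq_single (⟨a, ha⟩ : Fin m)]
  · simp [mul_add_div_fin]
  · intro u hu
    refine Finset.sum_eq_zero fun w _ => ?_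
    rw [mul_add_div_fin, if_neg fun h => hu (Fin.ext h)]

theorem sum_range_mul_mod {m n a : ℕ} (ha : a < n) (g : ℕ → ℕ) :
    ∑ x ∈ Finset.range (m * n), (if x % n = a then g x else 0) =
      ∑ u : Fin m, g (u * n + a) := by
  rw [sum_range_mul_eq]
  refine Finset.sum_congr rfl fun u _ => ?_
  rw [Fintype.sum_eq_single (⟨a, ha⟩ : Fin n)]
  · exact if_pos (mul_add_mod_fin (n := n) u ⟨a, ha⟩)
  · intro w hw
    rw [mul_add_mod_fin, if_neg fun h => hw (Fin.ext h)]

open Classical in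
theorem adjArray_apply {n : ℕ} (G : SimpleGraph (Fin n)) (u v : Fin n) :
    adjArray G (u * n + v) = if G.Adj u v then 1 else 0 := by
  unfold adjArray
  congr 1
  refine propext ⟨?_, fun h => ⟨u, v, rfl, h⟩⟩
  rintro ⟨i, j, h, hadj⟩
  have h1 := congrArg (· / n) h
  have h2 := congrArg (· % n) h
  simp only [mul_add_div_fin, mul_add_mod_fin] at h1 h2
  rwa [Fin.ext h1, Fin.ext h2]

open Classical in
theorem adjArray_add_eq {n : ℕ} (G : SimpleGraph (Fin n)) (u v : Fin n) :
    adjArray G (u * n + v) + (if (u : ℕ) = v then 1 else 0) = if Cl G u v then 1 else 0 := by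
  rw [adjArray_apply, Cl]
  by_cases h : u = v
  · subst h
    simp
  · simp [h, Fin.val_inj]

theorem adjArray_le_one {n : ℕ} (G : SimpleGraph (Fin n)) (x : ℕ) : adjArray G x ≤ 1 := by
  unfold adjArray
  split_ifs <;> simp

/-! ### Analysis of the instance -/

instance : Add Expr := ⟨.op .add⟩

instance : Sub Expr := ⟨.op .sub⟩

instance : Mul Expr := ⟨.op .mul⟩

instance : Div Expr := ⟨.op .div⟩

instance : Mod Expr := ⟨.op .mod⟩

namespace Expr

variable (s : State) (e f : Expr)

@[simp] theorem eval_add : (e + f).eval s = e.eval s + f.eval s := rfl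

@[simp] theorem eval_sub : (e - f).eval s = e.eval s - f.eval s := rfl

@[simp] theorem eval_mul : (e * f).eval s = e.eval s * f.eval s := rfl

@[simp] theorem eval_div : (e / f).eval s = e.eval s / f.eval s := rfl

@[simp] theorem eval_mod : (e % f).eval s = e.eval s % f.eval s := rfl

@[simp] theorem eval_lt :
    (op .lt e f).eval s = if e.eval s < f.eval s then 1 else 0 := rfl

@[simp] theorem eval_eq :
    (op .eq e f).eval s = if e.eval s = f.eval s then 1 else 0 := rfl

@[simp] theorem eval_const (c : ℕ) : (const c).eval s = c := rfl

@[simp] theorem eval_reg (r : ℕ) : (reg r).eval s = s.reg r := rfl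

@[simp] theorem eval_load (a : ℕ) : (load a e).eval s = s.mem a (e.eval s) := rfl

/-- The register that counts the rounds of the loops. -/
abbrev idx : Expr := reg 3

/-- The row of the matrix position in the counting register. -/
abbrev row : Expr := idx / reg 0

/-- The column of the matrix position in the counting register. -/
abbrev col : Expr := idx % reg 0

/-- Whether `e` and `f` are equal or adjacent in the graph of array `0`. -/
abbrev cl (e f : Expr) : Expr := load 0 (e * reg 0 + f) + op .eq e f

end Expr

open DynamicCluster.Expr

/-- State in which the input is unchanged, the registers `4` and `5` hold `n ^ 2` and `n ^ 3`, and
the arrays from `j` on are empty. -/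
structure Base (I : DCInstance) (j : ℕ) (s : State) : Prop where
  reg_zero : s.reg 0 = I.n
  reg_one : s.reg 1 = I.k
  reg_two : s.reg 2 = I.d
  reg_four : s.reg 4 = I.n * I.n
  reg_five : s.reg 5 = I.n * I.n * I.n
  mem_zero : s.mem 0 = adjArray I.G
  mem_one : s.mem 1 = adjArray I.Gc
  mem_eq_zero : ∀ B, j ≤ B → ∀ a, s.mem B a = 0

/-- An accumulation loop writes array `j` and leaves everything else as it is. -/
theorem Base.acc {I : DCInstance} {j : ℕ} {s : State} {p : Prog} (h : Base I j s) {N M : ℕ}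
    {addr val : Expr} (hp : p = .acc 3 N j addr val) (hj : 2 ≤ j) (hN : 3 ≠ N)
    (ha : addr.avoids j = true) (hv : val.avoids j = true) (hM : s.reg N = M)
    (hMn : M ≤ I.n ^ 3) :
    p.Ok I.n s ∧ Base I (j + 1) (p.sem s) ∧ (∀ B < j, (p.sem s).mem B = s.mem B) ∧
      ∀ a, (p.sem s).mem j a = ∑ x ∈ Finset.range M,
        if addr.eval (s.setReg 3 x) = a then val.eval (s.setReg 3 x) else 0 := by
  subst hM
  subst hp
  have hm : ∀ B, B ≠ j → ((Prog.acc 3 N j addr val).sem s).mem B = s.mem B := fun B hB => by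
    simp [Prog.sem, accState, hB]
  have hr : ∀ r, r ≠ 3 → ((Prog.acc 3 N j addr val).sem s).reg r = s.reg r := fun r hr => by
    simp [Prog.sem, accState, hr]
  refine ⟨⟨hN, ha, hv, by omega⟩, ?_, fun B hB => hm B hB.ne, fun a => ?_⟩
  · exact
      { reg_zero := (hr 0 (by decide)).trans h.reg_zero
        reg_one := (hr 1 (by decide)).trans h.reg_one
        reg_two := (hr 2 (by decide)).trans h.reg_two
        reg_four := (hr 4 (by decide)).trans h.reg_four
        reg_five := (hr 5 (by decide)).trans h.reg_five
        mem_zero := (hm 0 (by omega)).trans h.mem_zero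
        mem_one := (hm 1 (by omega)).trans h.mem_one
        mem_eq_zero := fun B hB a => by
          rw [hm B (by omega)]
          exact h.mem_eq_zero B (by omega) a }
  · simp [Prog.sem, accState, h.mem_eq_zero j le_rfl a]

theorem Prog.seq_ok {n : ℕ} {p q : Prog} {s : State} {P : State → Prop} (hp : p.Ok n s)
    (hq : q.Ok n (p.sem s) ∧ P (q.sem (p.sem s))) :
    (Prog.seq p q).Ok n s ∧ P ((Prog.seq p q).sem s) :=
  ⟨⟨hp, hq.1⟩, hq.2⟩

/-- The threshold as an expression. -/
def thresholdExpr : Distance → Expr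
  | .matching => const 2 * reg 1 + reg 2 + const 1
  | .edge => const 2 * reg 1 + const 1

/-- Whether all bad vertices that are not removed with their component are kept. -/
def keepBad : Distance → ℕ
  | .matching => 0
  | .edge => 1

def initProg : Prog := .seq (.assign 4 (reg 0 * reg 0)) (.assign 5 (reg 0 * reg 0 * reg 0))

/-- `A₂[v] ≠ 0` iff `v` is bad. -/
def badProg : Prog := .acc 3 4 2 row (const 1 - op .eq (load 0 idx) (load 1 idx))

/-- `A₃[v] ≠ 0` iff the component of `v` is not common. -/
def commonProg : Prog := .acc 3 4 3 row ((load 1 idx + op .eq row col) * load 2 col)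

/-- `A₄[u n + v] = 0` iff `u` and `v` have the same closed neighborhood in `G`. -/
def nbhdProg : Prog :=
  .acc 3 5 4 row (const 1 - op .eq (cl (row / reg 0) col) (cl (row % reg 0) col))

/-- `A₅[v]` is the number of the twins that precede `v`. -/
def twinProg : Prog :=
  .acc 3 4 5 col (op .lt row col * op .eq (load 4 idx) (const 0) * load 1 idx)

/-- `A₆[v]` indicates whether `v` is kept. -/
def keepProg (δ : Distance) : Prog :=
  .acc 3 0 6 idx (op .lt (const 0) (load 3 idx) * op .lt (const 0)
    (const (keepBad δ) * op .lt (const 0) (load 2 idx) +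
      op .lt (load 5 idx) (thresholdExpr δ)))

/-- `A₇[v]` is the number of kept vertices that precede `v`. -/
def posProg : Prog := .acc 3 4 7 col (load 6 row * op .lt row col)

/-- `A₈[0]` is the number of kept vertices. -/
def sizeProg : Prog := .acc 3 0 8 (const 0) (load 6 idx)

/-- `A₉[0]` is twice the edge-based distance of the two graphs. -/
def diffProg : Prog := .acc 3 4 9 (const 0) (const 1 - op .eq (load 0 idx) (load 1 idx))

/-- `A₁₀[0] = 0` iff `G` is a cluster graph. -/
def clusterProg : Prog := .acc 3 4 10 (const 0) (load 0 idx * load 4 idx)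

/-- The result of the analysis of the instance `I`. -/
structure Analyzed (δ : Distance) (I : DCInstance) (s : State) : Prop where
  base : Base I 11 s
  keep_of_mem : ∀ v ∈ keptSet δ I.G I.Gc I.k I.d, s.mem 6 v = 1
  keep_of_notMem : ∀ v ∉ keptSet δ I.G I.Gc I.k I.d, s.mem 6 v = 0
  pos : ∀ v : Fin I.n, s.mem 7 v = ((keptSet δ I.G I.Gc I.k I.d).filter (· < v)).card
  size : s.mem 8 0 = (keptSet δ I.G I.Gc I.k I.d).card
  diff : s.mem 9 0 = 2 * edgeDist I.G I.Gc
  cluster : s.mem 10 0 = 0 ↔ IsClusterGraph I.G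

/-- The stages fill the arrays 2 to 10 in this order; each finds its target array still zero and
reads only earlier ones. -/
def analysisProg (δ : Distance) : Prog :=
  .seq initProg <| .seq badProg <| .seq commonProg <| .seq nbhdProg <| .seq twinProg <|
    .seq (keepProg δ) <| .seq posProg <| .seq sizeProg <| .seq diffProg clusterProg

/-- Truncated subtraction from 1 serves as negation, so a universal statement becomes the vanishing
of a sum of indicators. -/
theorem one_sub_ite_eq_zero {p : Prop} [Decidable p] : 1 - (if p then 1 else 0) = 0 ↔ p := by
  split_ifs with h <;> simp [h]

section Stages

variable {I : DCInstance} {s : State}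

theorem base_initProg (I : DCInstance) :
    initProg.Ok I.n I.input ∧ Base I 2 (initProg.sem I.input) := by
  refine ⟨⟨trivial, trivial⟩, ?_⟩
  constructor <;> try simp [initProg, Prog.sem, State.setReg, DCInstance.input]
  intro B hB
  rw [if_neg (by omega), if_neg (by omega)]
  simp

theorem differ_iff_adjArray {G Gc : SimpleGraph (Fin I.n)} (u v : Fin I.n) :
    Differ G Gc u v ↔ adjArray G (u * I.n + v) ≠ adjArray Gc (u * I.n + v) := by
  rw [adjArray_apply, adjArray_apply, Differ]
  split_ifs <;> simp_all

theorem sum_bad (v : Fin I.n) {m : ℕ → ℕ} (hs : ∀ a, m a = ∑ x ∈ Finset.range (I.n * I.n),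
      if x / I.n = a then 1 - (if adjArray I.G x = adjArray I.Gc x then 1 else 0) else 0) :
    m v = 0 ↔ ¬ Bad I.G I.Gc v := by
  rw [hs, sum_range_mul_div v.isLt, Finset.sum_eq_zero_iff]
  simp only [Finset.mem_univ, true_imp_iff, one_sub_ite_eq_zero, Bad, differ_iff_adjArray,
    not_exists, not_not]

theorem sum_common (v : Fin I.n) {m₂ m₃ : ℕ → ℕ}
    (h₂ : ∀ v : Fin I.n, m₂ v = 0 ↔ ¬ Bad I.G I.Gc v)
    (h₃ : ∀ a, m₃ a = ∑ x ∈ Finset.range (I.n * I.n), if x / I.n = a then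
      (adjArray I.Gc x + (if x / I.n = x % I.n then 1 else 0)) * m₂ (x % I.n) else 0) :
    m₃ v = 0 ↔ Common I.G I.Gc v := by
  rw [h₃, sum_range_mul_div v.isLt, Finset.sum_eq_zero_iff]
  simp only [Finset.mem_univ, true_imp_iff, mul_add_div_fin, mul_add_mod_fin, adjArray_add_eq,
    mul_eq_zero, h₂, Common, ite_eq_right_iff, one_ne_zero, imp_false]
  exact forall_congr' fun w => by tauto

/-- The only stage with n³ rounds: the counter encodes the triple `u, v, w`. -/
theorem sum_nbhd (u v : Fin I.n) {m : ℕ → ℕ}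
    (hs : ∀ a, m a = ∑ x ∈ Finset.range (I.n * I.n * I.n), if x / I.n = a then
      1 - (if adjArray I.G (x / I.n / I.n * I.n + x % I.n) +
          (if x / I.n / I.n = x % I.n then 1 else 0) =
        adjArray I.G (x / I.n % I.n * I.n + x % I.n) +
          (if x / I.n % I.n = x % I.n then 1 else 0) then 1 else 0) else 0) :
    m (u * I.n + v) = 0 ↔ ∀ w, Cl I.G u w ↔ Cl I.G v w := by
  rw [hs, sum_range_mul_div (mul_add_lt_mul u v), Finset.sum_eq_zero_iff]
  simp only [Finset.mem_univ, true_imp_iff, mul_add_div_fin, mul_add_mod_fin, adjArray_add_eq,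
    one_sub_ite_eq_zero]
  refine forall_congr' fun w => ?_
  split_ifs <;> simp_all

theorem sum_twin (v : Fin I.n) {m₄ m₅ : ℕ → ℕ}
    (h₄ : ∀ u v : Fin I.n, m₄ (u * I.n + v) = 0 ↔ ∀ w, Cl I.G u w ↔ Cl I.G v w)
    (h₅ : ∀ a, m₅ a = ∑ x ∈ Finset.range (I.n * I.n), if x % I.n = a then
      (if x / I.n < x % I.n then 1 else 0) * (if m₄ x = 0 then 1 else 0) * adjArray I.Gc x
      else 0) :
    m₅ v = (prevTwins I.G I.Gc v).card := by
  classical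
  rw [h₅, sum_range_mul_mod v.isLt, prevTwins, Finset.card_filter]
  refine Finset.sum_congr rfl fun u _ => ?_
  rw [mul_add_div_fin, mul_add_mod_fin, adjArray_apply]
  simp only [h₄, Twin, Fin.lt_def]
  by_cases huv : (u : ℕ) < v
  · have hne : u ≠ v := Fin.ne_of_lt huv
    simp only [Cl, hne, false_or, huv, true_and, if_true, one_mul]
    by_cases h1 : ∀ w, (u = w ∨ I.G.Adj u w) ↔ (v = w ∨ I.G.Adj v w)
    · simp [h1]
    · simp [h1]
  · simp [huv]

theorem sum_keep {δ : Distance} (v : Fin I.n) {m₂ m₃ m₅ m₆ : ℕ → ℕ}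
    (h₂ : ∀ v : Fin I.n, m₂ v = 0 ↔ ¬ Bad I.G I.Gc v)
    (h₃ : ∀ v : Fin I.n, m₃ v = 0 ↔ Common I.G I.Gc v)
    (h₅ : ∀ v : Fin I.n, m₅ v = (prevTwins I.G I.Gc v).card)
    (h₆ : ∀ a, m₆ a = ∑ x ∈ Finset.range I.n, if x = a then (if 0 < m₃ x then 1 else 0) *
      (if 0 < keepBad δ * (if 0 < m₂ x then 1 else 0) +
        (if m₅ x < δ.threshold I.k I.d then 1 else 0) then 1 else 0) else 0) :
    m₆ v = if v ∈ keptSet δ I.G I.Gc I.k I.d then 1 else 0 := by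
  rw [h₆, Finset.sum_ite_eq', if_pos (Finset.mem_range.2 v.isLt)]
  have hc := h₃ v
  have hb := h₂ v
  simp only [h₅, keptSet, Finset.mem_filter, Finset.mem_univ, true_and]
  by_cases h1 : Common I.G I.Gc v
  · simp [h1, hc.2 h1]
  have h3 := Nat.pos_of_ne_zero (mt hc.1 h1)
  by_cases h5 : (prevTwins I.G I.Gc v).card < δ.threshold I.k I.d
  · simp [h1, h3, h5]
  by_cases h2 : Bad I.G I.Gc v
  · have h2' : 0 < m₂ v := Nat.pos_of_ne_zero fun h => hb.1 h h2
    cases δ <;> simp [h1, h2, h2', h3, h5, keepBad]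
  · simp [h1, h2, hb.2 h2, h3, h5]

theorem sum_pos {S : Finset (Fin I.n)} (v : Fin I.n) {m₆ m₇ : ℕ → ℕ}
    (h₆ : ∀ v : Fin I.n, m₆ v = if v ∈ S then 1 else 0)
    (h₇ : ∀ a, m₇ a = ∑ x ∈ Finset.range (I.n * I.n), if x % I.n = a then
      m₆ (x / I.n) * (if x / I.n < x % I.n then 1 else 0) else 0) :
    m₇ v = (S.filter (· < v)).card := by
  rw [h₇, sum_range_mul_mod v.isLt, ← Finset.filter_univ_mem S, Finset.filter_filter,
    Finset.card_filter]
  refine Finset.sum_congr rfl fun u _ => ?_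
  rw [mul_add_div_fin, mul_add_mod_fin, h₆]
  simp only [Fin.lt_def]
  split_ifs <;> simp_all

theorem sum_size {S : Finset (Fin I.n)} {m₆ : ℕ → ℕ} {t : ℕ}
    (h₆ : ∀ v : Fin I.n, m₆ v = if v ∈ S then 1 else 0)
    (ht : t = ∑ x ∈ Finset.range I.n, m₆ x) : t = S.card := by
  rw [ht, Finset.sum_range, ← Finset.filter_univ_mem S, Finset.card_filter]
  exact Finset.sum_congr rfl fun u _ => h₆ u

theorem sum_diff {t : ℕ} (ht : t = ∑ x ∈ Finset.range (I.n * I.n),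
      (1 - (if adjArray I.G x = adjArray I.Gc x then 1 else 0))) :
    t = 2 * edgeDist I.G I.Gc := by
  classical
  rw [ht, sum_range_mul_eq, two_mul_edgeDist]
  refine Finset.sum_congr rfl fun u _ => ?_
  rw [Finset.card_filter]
  refine Finset.sum_congr rfl fun v _ => ?_
  simp only [differ_iff_adjArray, ne_eq]
  split_ifs <;> simp_all

theorem sum_cluster {t : ℕ} {m₄ : ℕ → ℕ}
    (h₄ : ∀ u v : Fin I.n, m₄ (u * I.n + v) = 0 ↔ ∀ w, Cl I.G u w ↔ Cl I.G v w)
    (ht : t = ∑ x ∈ Finset.range (I.n * I.n), adjArray I.G x * m₄ x) :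
    t = 0 ↔ IsClusterGraph I.G := by
  rw [ht, sum_range_mul_eq, isClusterGraph_iff_cl_congr]
  simp only [Finset.sum_eq_zero_iff, Finset.mem_univ, true_imp_iff, mul_eq_zero, h₄,
    adjArray_apply, ite_eq_right_iff, one_ne_zero, imp_false]
  exact forall_congr' fun u => forall_congr' fun v => by tauto

end Stages

set_option maxHeartbeats 1000000 in
theorem analyzed_analysisProg (δ : Distance) (I : DCInstance) :
    (analysisProg δ).Ok I.n I.input ∧ Analyzed δ I ((analysisProg δ).sem I.input) := by
  classical
  have hn1 : I.n ≤ I.n ^ 3 := Nat.le_self_pow (by decide) _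
  have hn3 : I.n * I.n * I.n ≤ I.n ^ 3 := by rw [pow_succ, pow_two]
  have hn2 : I.n * I.n ≤ I.n ^ 3 := by
    rcases Nat.eq_zero_or_pos I.n with h | h
    · simp [h]
    · exact (Nat.le_mul_of_pos_right _ h).trans hn3
  obtain ⟨ok₁, b₁⟩ := base_initProg I
  refine Prog.seq_ok ok₁ ?_
  -- Only the recorded facts about each intermediate state are used later, so its defining term is
  -- forgotten.
  generalize initProg.sem I.input = s₁ at *
  obtain ⟨ok₂, b₂, -, e₂⟩ := b₁.acc (p := badProg) rfl le_rfl (by decide) rfl rfl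
    b₁.reg_four hn2
  refine Prog.seq_ok ok₂ ?_
  generalize badProg.sem s₁ = s₂ at *
  have f₂ : ∀ v : Fin I.n, s₂.mem 2 v = 0 ↔ ¬ Bad I.G I.Gc v := fun v => sum_bad v fun a => by
    simpa [State.setReg, b₁.reg_zero, b₁.mem_zero, b₁.mem_one] using e₂ a
  obtain ⟨ok₃, b₃, m₃, e₃⟩ := b₂.acc (p := commonProg) rfl (by decide) (by decide) rfl rfl
    b₂.reg_four hn2
  refine Prog.seq_ok ok₃ ?_
  generalize commonProg.sem s₂ = s₃ at *
  have f₃ : ∀ v : Fin I.n, s₃.mem 3 v = 0 ↔ Common I.G I.Gc v := fun v =>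
    sum_common v f₂ fun a => by
      simpa [State.setReg, b₂.reg_zero, b₂.mem_zero, b₂.mem_one] using e₃ a
  rw [← m₃ 2 (by decide)] at f₂
  obtain ⟨ok₄, b₄, m₄, e₄⟩ := b₃.acc (p := nbhdProg) rfl (by decide) (by decide) rfl rfl
    b₃.reg_five hn3
  refine Prog.seq_ok ok₄ ?_
  generalize nbhdProg.sem s₃ = s₄ at *
  have f₄ : ∀ u v : Fin I.n, s₄.mem 4 (u * I.n + v) = 0 ↔ ∀ w, Cl I.G u w ↔ Cl I.G v w :=
    fun u v => sum_nbhd u v fun a => by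
      simpa [State.setReg, b₃.reg_zero, b₃.mem_zero, b₃.mem_one] using e₄ a
  rw [← m₄ 2 (by decide)] at f₂
  rw [← m₄ 3 (by decide)] at f₃
  obtain ⟨ok₅, b₅, m₅, e₅⟩ := b₄.acc (p := twinProg) rfl (by decide) (by decide) rfl rfl
    b₄.reg_four hn2
  refine Prog.seq_ok ok₅ ?_
  generalize twinProg.sem s₄ = s₅ at *
  have f₅ : ∀ v : Fin I.n, s₅.mem 5 v = (prevTwins I.G I.Gc v).card :=
    fun v => sum_twin v f₄ fun a => by
      simpa [State.setReg, b₄.reg_zero, b₄.mem_zero, b₄.mem_one] using e₅ a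
  rw [← m₅ 2 (by decide)] at f₂
  rw [← m₅ 3 (by decide)] at f₃
  rw [← m₅ 4 (by decide)] at f₄
  obtain ⟨ok₆, b₆, m₆, e₆⟩ := b₅.acc (p := keepProg δ) rfl (by decide) (by decide) rfl
    (by cases δ <;> rfl) b₅.reg_zero hn1
  refine Prog.seq_ok ok₆ ?_
  generalize (keepProg δ).sem s₅ = s₆ at *
  have f₆ : ∀ v : Fin I.n, s₆.mem 6 v = if v ∈ keptSet δ I.G I.Gc I.k I.d then 1 else 0 := by
    refine fun v => sum_keep v f₂ f₃ f₅ fun a => ?_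
    have hthr : ∀ x, (thresholdExpr δ).eval (s₅.setReg 3 x) = δ.threshold I.k I.d := by
      cases δ <;> simp [thresholdExpr, Distance.threshold, State.setReg, b₅.reg_one, b₅.reg_two]
    refine (e₆ a).trans (Finset.sum_congr rfl fun x _ => ?_)
    simp [State.setReg, ← hthr x]
  rw [← m₆ 4 (by decide)] at f₄
  obtain ⟨ok₇, b₇, m₇, e₇⟩ := b₆.acc (p := posProg) rfl (by decide) (by decide) rfl rfl
    b₆.reg_four hn2
  refine Prog.seq_ok ok₇ ?_
  generalize posProg.sem s₆ = s₇ at *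
  have f₇ : ∀ v : Fin I.n,
      s₇.mem 7 v = ((keptSet δ I.G I.Gc I.k I.d).filter (· < v)).card := by
    refine fun v => sum_pos v f₆ fun a => ?_
    simpa [State.setReg, b₆.reg_zero] using e₇ a
  rw [← m₇ 4 (by decide)] at f₄
  rw [← m₇ 6 (by decide)] at f₆
  obtain ⟨ok₈, b₈, m₈, e₈⟩ := b₇.acc (p := sizeProg) rfl (by decide) (by decide) rfl rfl
    b₇.reg_zero hn1
  refine Prog.seq_ok ok₈ ?_
  generalize sizeProg.sem s₇ = s₈ at *
  have f₈ : s₈.mem 8 0 = (keptSet δ I.G I.Gc I.k I.d).card := sum_size f₆ (by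
    simpa [State.setReg, b₇.reg_zero] using e₈ 0)
  rw [← m₈ 4 (by decide)] at f₄
  rw [← m₈ 6 (by decide)] at f₆
  rw [← m₈ 7 (by decide)] at f₇
  obtain ⟨ok₉, b₉, m₉, e₉⟩ := b₈.acc (p := diffProg) rfl (by decide) (by decide) rfl rfl
    b₈.reg_four hn2
  refine Prog.seq_ok ok₉ ?_
  generalize diffProg.sem s₈ = s₉ at *
  have f₉ : s₉.mem 9 0 = 2 * edgeDist I.G I.Gc := sum_diff (by
    simpa [State.setReg, b₈.mem_zero, b₈.mem_one] using e₉ 0)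
  rw [← m₉ 4 (by decide)] at f₄
  rw [← m₉ 6 (by decide)] at f₆
  rw [← m₉ 7 (by decide)] at f₇
  rw [← m₉ 8 (by decide)] at f₈
  obtain ⟨ok₁₀, b₁₀, m₁₀, e₁₀⟩ := b₉.acc (p := clusterProg) rfl (by decide) (by decide) rfl
    rfl b₉.reg_four hn2
  refine ⟨ok₁₀, ?_⟩
  generalize clusterProg.sem s₉ = s at *
  have f₁₀ : s.mem 10 0 = 0 ↔ IsClusterGraph I.G := sum_cluster f₄ (by
    simpa [State.setReg, b₉.mem_zero] using e₁₀ 0)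
  rw [← m₁₀ 6 (by decide)] at f₆
  rw [← m₁₀ 7 (by decide)] at f₇
  rw [← m₁₀ 8 (by decide)] at f₈
  rw [← m₁₀ 9 (by decide)] at f₉
  exact ⟨b₁₀, fun v hv => (f₆ v).trans (if_pos hv), fun v hv => (f₆ v).trans (if_neg hv), f₇, f₈,
    f₉, f₁₀⟩

/-! ### Output of the reduced instance -/

/-- The embedding of `{0, …, |S| - 1}` onto the set of vertices `S`. -/
def setEmb {n : ℕ} (S : Finset (Fin n)) : Fin S.card ↪ Fin n := (S.orderEmbOfFin rfl).toEmbedding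

theorem mem_range_setEmb {n : ℕ} {S : Finset (Fin n)} (v : Fin n) :
    v ∈ Set.range (setEmb S) ↔ v ∈ S := by
  have h := S.range_orderEmbOfFin rfl
  change v ∈ Set.range (S.orderEmbOfFin rfl) ↔ v ∈ S
  rw [h, Finset.mem_coe]

/-- The embedding is increasing, so the number of kept predecessors computed in array 7 inverts it.
-/
theorem card_filter_lt_setEmb {n : ℕ} (S : Finset (Fin n)) (i : Fin S.card) :
    (S.filter (· < setEmb S i)).card = i := by
  have h : S.filter (· < setEmb S i) = (Finset.Iio i).map (setEmb S) := by
    ext v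
    simp only [Finset.mem_filter, Finset.mem_map, Finset.mem_Iio]
    constructor
    · rintro ⟨hv, hlt⟩
      obtain ⟨j, rfl⟩ := (mem_range_setEmb v).2 hv
      exact ⟨j, (S.orderEmbOfFin rfl).lt_iff_lt.1 hlt, rfl⟩
    · rintro ⟨j, hj, rfl⟩
      exact ⟨(mem_range_setEmb _).1 ⟨j, rfl⟩, (S.orderEmbOfFin rfl).lt_iff_lt.2 hj⟩
  rw [h, Finset.card_map, Fin.card_Iio]

/-- The instance induced by the set of vertices `S`. -/
def DCInstance.induced (I : DCInstance) (S : Finset (Fin I.n)) : DCInstance where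
  n := S.card
  G := I.G.comap (setEmb S)
  Gc := I.Gc.comap (setEmb S)
  isClusterGraph_Gc := I.isClusterGraph_Gc.comap (setEmb S)
  k := I.k
  d := I.d

/-- Collecting the entries of an adjacency matrix at kept positions. -/
theorem sum_scatter {n : ℕ} (S : Finset (Fin n)) (H : SimpleGraph (Fin n)) {m₆ m₇ : ℕ → ℕ}
    (h₆ : ∀ v ∈ S, m₆ v = 1) (h₆' : ∀ v ∉ S, m₆ v = 0)
    (h₇ : ∀ v : Fin n, m₇ v = (S.filter (· < v)).card) {x : ℕ} (hx : x < S.card * S.card) :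
    (∑ y ∈ Finset.range (n * n), if m₇ (y / n) * S.card + m₇ (y % n) = x then
      m₆ (y / n) * m₆ (y % n) * adjArray H y else 0) = adjArray (H.comap (setEmb S)) x := by
  obtain ⟨i, j, rfl⟩ : ∃ i j : Fin S.card, (i : ℕ) * S.card + j = x := by
    have hpos : 0 < S.card := Nat.pos_of_ne_zero fun h => by simp [h] at hx
    exact ⟨⟨x / S.card, Nat.div_lt_of_lt_mul hx⟩, ⟨x % S.card, Nat.mod_lt _ hpos⟩,
      Nat.div_add_mod' _ _⟩
  have hpos : ∀ i : Fin S.card, m₇ (setEmb S i) = i := fun i => by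
    rw [h₇, card_filter_lt_setEmb]
  have hmem : ∀ i : Fin S.card, m₆ (setEmb S i) = 1 := fun i =>
    h₆ _ ((mem_range_setEmb _).1 ⟨i, rfl⟩)
  rw [sum_range_mul_eq, ← Fintype.sum_prod_type',
    Fintype.sum_eq_single (setEmb S i, setEmb S j)]
  · simp only [mul_add_div_fin, mul_add_mod_fin, hpos, hmem, if_true, one_mul, adjArray_apply]
    rfl
  · rintro ⟨u, v⟩ huv
    simp only [mul_add_div_fin, mul_add_mod_fin]
    -- Other kept pairs have a different address. A pair with a discarded vertex may share the
    -- address, but its value is zero.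
    by_cases hu : u ∈ S
    · by_cases hv : v ∈ S
      · obtain ⟨i', rfl⟩ := (mem_range_setEmb u).2 hu
        obtain ⟨j', rfl⟩ := (mem_range_setEmb v).2 hv
        rw [hpos, hpos]
        refine if_neg fun h => huv ?_
        have h1 := congrArg (· / S.card) h
        have h2 := congrArg (· % S.card) h
        simp only [mul_add_div_fin, mul_add_mod_fin] at h1 h2
        rw [Fin.ext h1, Fin.ext h2]
      · simp [h₆' v hv]
    · simp [h₆' u hu]

/-- Collect the kept entries of array `src` in array `j`. -/
def scatterProg (src j : ℕ) : Prog :=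
  .acc 3 4 j (load 7 row * load 8 (const 0) + load 7 col) (load 6 row * load 6 col * load src idx)

/-- Overwrite the input with the induced instance. -/
def copyProg : Prog :=
  .seq (.assign 9 (load 8 (const 0) * load 8 (const 0))) <| .seq (.fill 3 9 0 (load 11 idx)) <|
    .seq (.fill 3 9 1 (load 12 idx)) (.assign 0 (load 8 (const 0)))

def outputProg : Prog := .seq (scatterProg 0 11) (.seq (scatterProg 1 12) copyProg)

/-- Output an instance without vertices. -/
def yesProg : Prog := .seq (.assign 0 (const 0)) (.seq (.assign 1 (const 0)) (.assign 2 (const 0)))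

/-- Output an instance with two vertices that are adjacent in the second graph only. -/
def noProg : Prog :=
  .seq (.assign 9 (const 4)) <| .seq (.fill 3 9 0 (const 0)) <|
    .seq (.fill 3 9 1 (op .eq idx (const 1) + op .eq idx (const 2))) <|
      .seq (.assign 0 (const 2)) (.seq (.assign 1 (const 0)) (.assign 2 (const 0)))

def trivialYes : DCInstance where
  n := 0
  G := ⊥
  Gc := ⊥
  isClusterGraph_Gc := fun u => u.elim0
  k := 0
  d := 0

def trivialNo : DCInstance where
  n := 2
  G := ⊥
  Gc := ⊤
  isClusterGraph_Gc := fun _ _ _ h => h.2.2.2 h.2.2.1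
  k := 0
  d := 0

theorem outputProg_spec {δ : Distance} {I : DCInstance} {s : State} (h : Analyzed δ I s) :
    outputProg.Ok I.n s ∧
      (I.induced (keptSet δ I.G I.Gc I.k I.d)).IsOutput (outputProg.sem s) := by
  generalize hS : keptSet δ I.G I.Gc I.k I.d = S
  have hsize := h.size
  have hk₁ := h.keep_of_mem
  have hk₂ := h.keep_of_notMem
  have hpos := h.pos
  have b := h.base
  rw [hS] at hsize hk₁ hk₂ hpos
  have hn3 : I.n * I.n * I.n ≤ I.n ^ 3 := by rw [pow_succ, pow_two]
  have hn2 : I.n * I.n ≤ I.n ^ 3 := by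
    rcases Nat.eq_zero_or_pos I.n with h | h
    · simp [h]
    · exact (Nat.le_mul_of_pos_right _ h).trans hn3
  have hSn : S.card * S.card ≤ I.n ^ 3 := by
    have h1 : S.card ≤ I.n := by simpa using S.card_le_univ
    exact (Nat.mul_le_mul h1 h1).trans hn2
  obtain ⟨ok₁, b₁, m₁, e₁⟩ := b.acc (p := scatterProg 0 11) rfl (by decide) (by decide) rfl rfl
    b.reg_four hn2
  refine Prog.seq_ok ok₁ ?_
  generalize (scatterProg 0 11).sem s = s₁ at *
  have f₁ : ∀ x < S.card * S.card, s₁.mem 11 x = adjArray (I.G.comap (setEmb S)) x := by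
    intro x hx
    rw [← sum_scatter S I.G hk₁ hk₂ hpos hx, e₁]
    simp [State.setReg, b.reg_zero, b.mem_zero, hsize]
  rw [← m₁ 6 (by decide)] at hk₁ hk₂
  rw [← m₁ 7 (by decide)] at hpos
  rw [← m₁ 8 (by decide)] at hsize
  obtain ⟨ok₂, b₂, m₂, e₂⟩ := b₁.acc (p := scatterProg 1 12) rfl (by decide) (by decide) rfl rfl
    b₁.reg_four hn2
  refine Prog.seq_ok ok₂ ?_
  generalize (scatterProg 1 12).sem s₁ = s₂ at *
  have f₂ : ∀ x < S.card * S.card, s₂.mem 12 x = adjArray (I.Gc.comap (setEmb S)) x := by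
    intro x hx
    rw [← sum_scatter S I.Gc hk₁ hk₂ hpos hx, e₂]
    simp [State.setReg, b₁.reg_zero, b₁.mem_one, hsize]
  rw [← m₂ 8 (by decide)] at hsize
  rw [← m₂ 11 (by decide)] at f₁
  refine ⟨⟨trivial, ⟨by decide, rfl, ?_⟩, ⟨by decide, rfl, ?_⟩, trivial⟩, ?_⟩
  · simp only [Prog.sem, State.setReg, eval_mul, eval_load, eval_const, hsize]
    simp only [Function.update_self]
    omega
  · simp only [Prog.sem, State.setReg, eval_mul, eval_load, eval_const, hsize, fillState]
    rw [Function.update_of_ne (by decide), Function.update_self]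
    omega
  · refine ⟨?_, ?_, ?_, fun x hx => ?_⟩
    · simp [copyProg, Prog.sem, State.setReg, fillState, hsize, DCInstance.induced]
    · simp [copyProg, Prog.sem, State.setReg, fillState, b₂.reg_one, DCInstance.induced]
    · simp [copyProg, Prog.sem, State.setReg, fillState, b₂.reg_two, DCInstance.induced]
    · change x < S.card ^ 2 at hx
      rw [pow_two] at hx
      change _ = adjArray (I.G.comap (setEmb S)) x ∧ _ = adjArray (I.Gc.comap (setEmb S)) x
      rw [← f₁ x hx, ← f₂ x hx]
      simp [copyProg, Prog.sem, State.setReg, fillState, hsize, hx]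

theorem yesProg_spec (n : ℕ) (s : State) :
    yesProg.Ok n s ∧ trivialYes.IsOutput (yesProg.sem s) := by
  refine ⟨⟨trivial, trivial, trivial⟩, ?_, ?_, ?_, fun x hx => ?_⟩
  · simp [yesProg, Prog.sem, State.setReg, trivialYes]
  · simp [yesProg, Prog.sem, State.setReg, trivialYes]
  · simp [yesProg, Prog.sem, State.setReg, trivialYes]
  · simp [trivialYes] at hx

theorem noProg_spec (n : ℕ) (s : State) :
    noProg.Ok n s ∧ trivialNo.IsOutput (noProg.sem s) := by
  refine ⟨⟨trivial, ⟨by decide, rfl, ?_⟩, ⟨by decide, rfl, ?_⟩, trivial, trivial, trivial⟩,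
    ?_, ?_, ?_, fun x hx => ?_⟩
  -- Four rounds are admissible even for `n = 0`, thanks to the factor 4 in `Prog.Ok`.
  · simp [Prog.sem, State.setReg]
  · simp [Prog.sem, State.setReg, fillState]
  · simp [noProg, Prog.sem, State.setReg, fillState, trivialNo]
  · simp [noProg, Prog.sem, State.setReg, fillState, trivialNo]
  · simp [noProg, Prog.sem, State.setReg, fillState, trivialNo]
  · change x < 2 ^ 2 at hx
    have h0 : (noProg.sem s).mem 0 x = 0 := by
      simp [noProg, Prog.sem, State.setReg, fillState]
      omega
    have h1 : (noProg.sem s).mem 1 x = (if x = 1 then 1 else 0) + if x = 2 then 1 else 0 := by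
      simp [noProg, Prog.sem, State.setReg, fillState]
      omega
    rw [h0, h1]
    obtain ⟨i, j, rfl⟩ : ∃ i j : Fin 2, (i : ℕ) * 2 + j = x :=
      ⟨⟨x / 2, by omega⟩, ⟨x % 2, by omega⟩, Nat.div_add_mod' _ _⟩
    have e0 : adjArray trivialNo.G (i * 2 + j) = 0 := by
      refine (adjArray_apply (n := 2) ⊥ i j).trans (if_neg ?_)
      simp
    have e1 := adjArray_apply (n := 2) ⊤ i j
    refine ⟨e0.symm, Eq.trans ?_ e1.symm⟩
    fin_cases i <;> fin_cases j <;> simp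

theorem trivialYes_isYes (δ : Distance) (m : Modification) : trivialYes.IsYes δ m := by
  refine ⟨(⊥ : SimpleGraph (Fin 0)), fun u => u.elim0, ?_, ?_, ?_⟩
  · exact (m.allows_iff _ _).2 fun _ _ => m.allowsPair_refl _
  · exact (edgeDist_self _).le
  · cases δ with
    | edge => exact (edgeDist_self _).le
    | matching =>
      change Fintype.card (Fin 0) - _ ≤ 0
      simp

/-- With k = 0 the solution must be `G`, and with d = 0 it must be `Gc`; for the matching distance
because the deleted set is empty. -/
theorem trivialNo_not_isYes (δ : Distance) (m : Modification) : ¬ trivialNo.IsYes δ m := by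
  rintro ⟨G', hG', -, hk, hd⟩
  have h0 : (⊥ : SimpleGraph (Fin 2)) = G' := eq_of_edgeDist_eq_zero (Nat.le_zero.1 hk)
  subst h0
  have key : ∀ x y : Fin 2,
      (⊥ : SimpleGraph (Fin 2)).Adj x y ↔ (⊤ : SimpleGraph (Fin 2)).Adj x y := by
    cases δ with
    | edge =>
      have h1 : (⊥ : SimpleGraph (Fin 2)) = ⊤ := eq_of_edgeDist_eq_zero (Nat.le_zero.1 hd)
      intro x y
      rw [h1]
    | matching =>
      obtain ⟨D, hD, h⟩ := (matchingDist_le_iff hG' trivialNo.isClusterGraph_Gc 0).1 hd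
      rw [Finset.card_eq_zero.1 (Nat.le_zero.1 hD)] at h
      exact fun x y => h x (Finset.notMem_empty _) y (Finset.notMem_empty _)
  have := key 0 1
  simp at this

/-! ### The kernel -/

theorem isYes_induced_iff (δ : Distance) (m : Modification) (I : DCInstance) :
    I.IsYes δ m ↔ (I.induced (keptSet δ I.G I.Gc I.k I.d)).IsYes δ m := by
  constructor
  · rintro ⟨G', h⟩
    exact ⟨G'.comap (setEmb (keptSet δ I.G I.Gc I.k I.d)),
      IsSolution.comap I.isClusterGraph_Gc (G' := G') h (setEmb (keptSet δ I.G I.Gc I.k I.d))⟩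
  · rintro ⟨G', h⟩
    exact exists_solution_of_keptSet I.isClusterGraph_Gc (setEmb _) mem_range_setEmb (G' := G') h

theorem card_le_of_isYes_matching {m : Modification} {I : DCInstance} (h : I.IsYes .matching m) :
    (keptSet .matching I.G I.Gc I.k I.d).card ≤ 40 * (I.k * I.k + I.d * I.d) := by
  obtain ⟨G', h⟩ := h
  refine (card_keptSet_matching I.isClusterGraph_Gc (G' := G') h).trans ?_
  have h1 := Nat.le_mul_self I.k
  have h2 := Nat.le_mul_self I.d
  have h4 : 2 * (I.k * I.d) ≤ I.k * I.k + I.d * I.d := by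
    zify
    nlinarith [sq_nonneg ((I.k : ℤ) - I.d)]
  nlinarith

/-- By the triangle inequality `G` and `Gc` differ in at most k+d pairs. The resulting bound
4(k+d)(k+1) has a linear term in d, which k·d absorbs only if k ≥ 1. -/
theorem card_le_of_isYes_edge {m : Modification} {I : DCInstance} (h : I.IsYes .edge m)
    (hk : I.k ≠ 0) :
    (keptSet .edge I.G I.Gc I.k I.d).card ≤ 8 * (I.k * I.k + I.k * I.d) := by
  obtain ⟨G', -, -, h1, h2⟩ := h
  have h3 : edgeDist I.G I.Gc ≤ I.k + I.d := by
    refine le_trans ?_ (Nat.add_le_add h1 h2)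
    refine (Set.ncard_le_ncard ?_ (Set.toFinite _)).trans (Set.ncard_union_le _ _)
    exact symmDiff_triangle _ _ _
  refine (card_keptSet_edge I.isClusterGraph_Gc h3).trans ?_
  have h4 : 1 ≤ I.k := Nat.one_le_iff_ne_zero.2 hk
  have h5 := Nat.le_mul_self I.k
  have h6 : I.d ≤ I.k * I.d := Nat.le_mul_of_pos_left _ h4
  nlinarith

theorem isYes_edge_iff_of_k_eq_zero {m : Modification} {I : DCInstance} (hk : I.k = 0) :
    I.IsYes .edge m ↔ IsClusterGraph I.G ∧ edgeDist I.G I.Gc ≤ I.d := by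
  constructor
  · rintro ⟨G', h1, -, h2, h3⟩
    rw [← eq_of_edgeDist_eq_zero (Nat.le_zero.1 (h2.trans hk.le))] at h1 h3
    exact ⟨h1, h3⟩
  · rintro ⟨h1, h2⟩
    exact ⟨I.G, h1, (m.allows_iff _ _).2 fun _ _ => m.allowsPair_refl _,
      (edgeDist_self _).le.trans (Nat.zero_le _), h2⟩

/-- Output the reduced instance, or a trivial instance if the answer is clear. -/
def decideProg : Distance → Prog
  | .matching =>
    .cond (op .lt (const 40 * (reg 1 * reg 1 + reg 2 * reg 2)) (load 8 (const 0))) noProg outputProg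
  | .edge =>
    .cond (reg 1)
      (.cond (op .lt (const 8 * (reg 1 * reg 1 + reg 1 * reg 2)) (load 8 (const 0)))
        noProg outputProg)
      (.cond (op .lt (const 2 * reg 2) (load 9 (const 0)) + load 10 (const 0)) noProg yesProg)

/-- The bound on the number of vertices of the kernel. -/
def Distance.size : Distance → ℕ → ℕ → ℕ
  | .matching => fun k d => k ^ 2 + d ^ 2
  | .edge => fun k d => k ^ 2 + k * d

theorem decideProg_spec {δ : Distance} (m : Modification) {I : DCInstance} {s : State}
    (h : Analyzed δ I s) :
    (decideProg δ).Ok I.n s ∧ ∃ J : DCInstance, J.IsOutput ((decideProg δ).sem s) ∧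
      (I.IsYes δ m ↔ J.IsYes δ m) ∧ J.n ≤ 40 * (δ.size I.k I.d + 1) ∧ J.k ≤ I.k ∧ J.d ≤ I.d := by
  have hout := outputProg_spec h
  have hno := noProg_spec I.n s
  have hyes := yesProg_spec I.n s
  have b := h.base
  have hnk : trivialNo.k ≤ I.k ∧ trivialNo.d ≤ I.d := ⟨Nat.zero_le _, Nat.zero_le _⟩
  have hyk : trivialYes.k ≤ I.k ∧ trivialYes.d ≤ I.d := ⟨Nat.zero_le _, Nat.zero_le _⟩
  have hnn : trivialNo.n ≤ 40 * (δ.size I.k I.d + 1) := by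
    change 2 ≤ _
    omega
  have hyn : trivialYes.n ≤ 40 * (δ.size I.k I.d + 1) := Nat.zero_le _
  have hiff := isYes_induced_iff δ m I
  have hno' := trivialNo_not_isYes δ m
  have hyes' := trivialYes_isYes δ m
  have hJ : ∀ B, (keptSet δ I.G I.Gc I.k I.d).card ≤ B →
      (I.induced (keptSet δ I.G I.Gc I.k I.d)).n ≤ B := fun _ h => h
  cases δ with
  | matching =>
    simp only [decideProg, Prog.Ok, Prog.sem, eval_lt, eval_mul, eval_add, eval_const, eval_reg,
      eval_load, b.reg_one, b.reg_two, h.size]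
    by_cases hc : 40 * (I.k * I.k + I.d * I.d) < (keptSet .matching I.G I.Gc I.k I.d).card
    · simp only [if_pos hc, ne_eq, one_ne_zero, not_false_eq_true, if_true]
      have : ¬ I.IsYes .matching m := fun hI => absurd (card_le_of_isYes_matching hI) (by omega)
      exact ⟨hno.1, trivialNo, hno.2, by tauto, hnn, hnk⟩
    · simp only [if_neg hc, ne_eq, not_true_eq_false, if_false]
      refine ⟨hout.1, _, hout.2, hiff, hJ _ ?_, le_rfl, le_rfl⟩
      simp only [Distance.size, pow_two]
      omega
  | edge =>
    simp only [decideProg, Prog.Ok, Prog.sem, eval_lt, eval_mul, eval_add, eval_const, eval_reg,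
      eval_load, b.reg_one, b.reg_two, h.size, h.diff]
    -- For k = 0 the answer is computed outright. Array 9 counts ordered pairs, hence the comparison
    -- with 2d.
    by_cases hk : I.k = 0
    · have hk₀ : ¬ (I.k ≠ 0) := fun h => h hk
      simp only [if_neg hk₀]
      have hk' := isYes_edge_iff_of_k_eq_zero (m := m) hk
      have hcl := h.cluster
      by_cases hc : IsClusterGraph I.G ∧ edgeDist I.G I.Gc ≤ I.d
      · rw [hcl.2 hc.1, if_neg (show ¬ 2 * I.d < 2 * edgeDist I.G I.Gc by omega)]
        simp only [add_zero, ne_eq, not_true_eq_false, if_false]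
        exact ⟨hyes.1, trivialYes, hyes.2, by tauto, hyn, hyk⟩
      · have hne : ¬ ((if 2 * I.d < 2 * edgeDist I.G I.Gc then 1 else 0) + s.mem 10 0 = 0) := by
          intro h0
          refine hc ⟨hcl.1 (by omega), ?_⟩
          by_contra hlt
          rw [if_pos (by omega)] at h0
          omega
        simp only [hne, ne_eq, not_false_eq_true, if_true]
        exact ⟨hno.1, trivialNo, hno.2, by tauto, hnn, hnk⟩
    · simp only [if_pos (show I.k ≠ 0 from hk)]
      by_cases hc : 8 * (I.k * I.k + I.k * I.d) < (keptSet .edge I.G I.Gc I.k I.d).card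
      · simp only [if_pos hc, ne_eq, one_ne_zero, not_false_eq_true, if_true]
        have : ¬ I.IsYes .edge m := fun hI => absurd (card_le_of_isYes_edge hI hk) (by omega)
        exact ⟨hno.1, trivialNo, hno.2, by tauto, hnn, hnk⟩
      · simp only [if_neg hc, ne_eq, not_true_eq_false, if_false]
        refine ⟨hout.1, _, hout.2, hiff, hJ _ ?_, le_rfl, le_rfl⟩
        simp only [Distance.size, pow_two]
        omega

theorem input_bounded (I : DCInstance) : I.input.Bounded (I.n + I.k + I.d + 2) := by
  constructor
  · intro r
    simp only [DCInstance.input]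
    split_ifs <;> omega
  · intro a i
    have h0 := adjArray_le_one I.G i
    have h1 := adjArray_le_one I.Gc i
    simp only [DCInstance.input]
    split_ifs
    · omega
    · omega
    · exact Nat.succ_pos _

theorem hasCubicTimeVertexKernel (δ : Distance) (m : Modification) :
    HasCubicTimeVertexKernel δ m δ.size := by
  -- The exponent 1 is that of the input, whose numbers are below n+k+d+2. The single constant
  -- chosen next dominates the word exponent `q`, the time factor `c` and the size factor 40.
  obtain ⟨q, c, -, h⟩ := (Prog.seq (analysisProg δ) (decideProg δ)).exec_compile 1
  refine ⟨(Prog.seq (analysisProg δ) (decideProg δ)).compile, q + c + 40, fun I => ?_⟩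
  obtain ⟨ok₁, h₁⟩ := analyzed_analysisProg δ I
  obtain ⟨ok₂, J, hJ, hiff, hn, hk, hd⟩ := decideProg_spec m h₁
  obtain ⟨-, t, ht, hexec⟩ := h I.n (I.n + I.k + I.d + 2) I.input
    ((I.n + I.k + I.d + 2) ^ (q + c + 40)) (by omega) ⟨ok₁, ok₂⟩
    (by simpa using input_bounded I) (Nat.pow_le_pow_right (by omega) (by omega))
  exact ⟨J, t, _, hexec, ht.trans (Nat.mul_le_mul_right _ (by omega)), hJ, hiff,
    hn.trans (Nat.mul_le_mul_right _ (by omega)), hk, hd⟩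

end DynamicCluster

theorem mainTheorem3 :
    (∀ m : DynamicCluster.Modification,
      DynamicCluster.HasCubicTimeVertexKernel .matching m (fun k d => k ^ 2 + d ^ 2)) ∧
    (∀ m : DynamicCluster.Modification,
      DynamicCluster.HasCubicTimeVertexKernel .edge m (fun k d => k ^ 2 + k * d)) :=
  ⟨fun m => DynamicCluster.hasCubicTimeVertexKernel .matching m,
    fun m => DynamicCluster.hasCubicTimeVertexKernel .edge m⟩
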